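/- Let $K$ be a field and let $X$ be a topological space. Let $C X$ be the differential graded algebra of singular cochains on $X$ with coefficients in $K$, with the cup product, and let $H^\bullet(X)$ be its cohomology algebra, regarded as a differential graded algebra with zero differential. For a differential graded algebra $A$ over $K$, the Hochschild cohomology $HH^\bullet(A)$ is the cohomology of the product total complex of the bicomplex $E_0^{s,t}=\mathrm{Hom}_K(A^{\otimes s},A)^t$, whose differentials are the internal one (induced by the differential of $A$) and the Hochschild one (the alternating sum of the usual cofaces, with Koszul signs). Filtering this complex by the columns $s\geqslant p$ gives the characteristic spectral sequence of $A$, called the Moore spectral sequence for $A=C X$. Its edge homomorphism $$HH^t(A)\longrightarrow E_2^{0,t}= Z^t_{\mathrm{gr}}(H^\bullet(A))\subseteq H^t(A)$$ takes values in the graded center $Z^t_{\mathrm{gr}}(H^\bullet(A))$ of the cohomology algebra and sends the class of a Hochschild cocycle $(\varphi_s)_{s\geqslant 0}$ of total degree $t$, with $\varphi_s\in\mathrm{Hom}_K(A^{\otimes s},A)^{t-s}$, to the cohomology class of $\varphi_0\in A^t$. Suppose that $X$ is formal over $K$, that is, there are a differential graded algebra $A$ over $K$ and homomorphisms $C X\leftarrow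 A\rightarrow H^\bullet(X)$ of differential graded algebras that induce isomorphisms in cohomology. Then for every integer $t$ the characteristic edge homomorphism $$HH^t(C X)\longrightarrow H^t(X)$$ of the Moore spectral sequence is surjective. -/

import Mathlib

universe u v w


/-- A (cohomologically graded, unital, associative) differential graded algebra over a field `K`,
given as the total space `⨁ₙ Aⁿ` with its internal grading by the integers.  In homological
notation, `Aⁿ = A₋ₙ`; the differential has cohomological degree `1`. -/
structure DGAlgebra (K : Type u) [Field K] where
  /-- the total space `⨁ₙ Aⁿ` -/
  carrier : Type w
  [ring : Ring carrier]
  [algebra : Algebra K carrier]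
  /-- `grading n` is the subspace `Aⁿ` -/
  grading : ℤ → Submodule K carrier
  [gradedAlgebra : GradedAlgebra grading]
  /-- the differential -/
  d : carrier →ₗ[K] carrier
  d_mem : ∀ (n : ℤ) (a : carrier), a ∈ grading n → d a ∈ grading (n + 1)
  d_d : ∀ a : carrier, d (d a) = 0
  leibniz : ∀ (n : ℤ) (a b : carrier), a ∈ grading n →
    d (a * b) = d a * b + (-1 : K) ^ n • (a * d b)

namespace DGAlgebra

variable {K : Type u} [Field K]

instance : CoeSort (DGAlgebra.{u, w} K) (Type w) := ⟨DGAlgebra.carrier⟩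

attribute [instance] DGAlgebra.ring DGAlgebra.algebra DGAlgebra.gradedAlgebra

/-- A homomorphism of differential graded algebras: a unital algebra homomorphism of degree `0`
that commutes with the differentials. -/
structure Hom (A : DGAlgebra.{u, v} K) (B : DGAlgebra.{u, w} K) where
  toAlgHom : A →ₐ[K] B
  map_mem : ∀ (n : ℤ) (a : A), a ∈ A.grading n → toAlgHom a ∈ B.grading n
  map_d : ∀ a : A, toAlgHom (A.d a) = B.d (toAlgHom a)

/-! ### Koszul signs -/

/-- The linear map that multiplies elements of degree `n` by `(-1) ^ (t * n)`. -/
noncomputable def koszul (A : DGAlgebra.{u, w} K) (t : ℤ) : A →ₗ[K] A :=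
  DirectSum.toModule K ℤ A (fun n => (-1 : K) ^ (t * n) • (A.grading n).subtype) ∘ₗ
    (DirectSum.decomposeLinearEquiv A.grading).toLinearMap

theorem koszul_apply (A : DGAlgebra.{u, w} K) (t : ℤ) {n : ℤ} {a : A} (ha : a ∈ A.grading n) :
    A.koszul t a = (-1 : K) ^ (t * n) • a := by
  have h := DirectSum.decomposeLinearEquiv_apply_coe (R := K) A.grading n ⟨a, ha⟩
  simp only at h
  simp only [koszul, LinearMap.comp_apply, LinearEquiv.coe_coe, h, DirectSum.toModule_lof]
  rfl

/-- Induction on homogeneous elements. -/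
theorem induction (A : DGAlgebra.{u, w} K) {P : A → Prop} (h0 : P 0)
    (hh : ∀ (n : ℤ) (a : A), a ∈ A.grading n → P a) (hadd : ∀ a b, P a → P b → P (a + b))
    (a : A) : P a :=
  DirectSum.Decomposition.inductionOn A.grading h0 (fun {i} m => hh i m m.2) hadd a

theorem neg_one_zpow_mul_self (n : ℤ) : (-1 : K) ^ n * (-1 : K) ^ n = 1 := by
  rw [← mul_zpow]; simp

theorem koszul_mul (A : DGAlgebra.{u, w} K) (t : ℤ) (a b : A) :
    A.koszul t (a * b) = A.koszul t a * A.koszul t b := by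
  induction a using A.induction with
  | h0 => simp
  | hadd a a' h h' => simp [add_mul, h, h']
  | hh m a ha =>
    induction b using A.induction with
    | h0 => simp
    | hadd a a' h h' => simp [mul_add, h, h']
    | hh n b hb =>
      rw [A.koszul_apply t ha, A.koszul_apply t hb, A.koszul_apply t (SetLike.mul_mem_graded ha hb),
        smul_mul_smul_comm, ← zpow_add₀ (by simp), mul_add]

theorem koszul_mem (A : DGAlgebra.{u, w} K) (t : ℤ) {n : ℤ} {a : A} (ha : a ∈ A.grading n) :
    A.koszul t a ∈ A.grading n := by
  rw [A.koszul_apply t ha]; exact Submodule.smul_mem _ _ ha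

theorem koszul_koszul (A : DGAlgebra.{u, w} K) (s t : ℤ) (a : A) :
    A.koszul s (A.koszul t a) = A.koszul (s + t) a := by
  induction a using A.induction with
  | h0 => simp
  | hadd a a' h h' => simp [h, h']
  | hh m a ha =>
    rw [A.koszul_apply t ha, map_smul, A.koszul_apply s ha, A.koszul_apply _ ha, smul_smul,
      ← zpow_add₀ (by simp)]
    congr 2; ring

theorem koszul_add_self (A : DGAlgebra.{u, w} K) (t : ℤ) (a : A) :
    A.koszul (t + t) a = a := by
  induction a using A.induction with
  | h0 => simp
  | hadd a a' h h' => simp [h, h']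
  | hh m a ha =>
    rw [A.koszul_apply _ ha, add_mul, zpow_add₀ (by simp), neg_one_zpow_mul_self, one_smul]

theorem d_koszul (A : DGAlgebra.{u, w} K) (t : ℤ) (a : A) :
    A.d (A.koszul t a) = (-1 : K) ^ t • A.koszul t (A.d a) := by
  induction a using A.induction with
  | h0 => simp
  | hadd a a' h h' => simp [h, h']
  | hh m a ha =>
    rw [A.koszul_apply t ha, A.koszul_apply t (A.d_mem m a ha), map_smul, smul_smul, mul_add,
      zpow_add₀ (by simp), mul_one, mul_left_comm, neg_one_zpow_mul_self, mul_one]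

/-- The Leibniz rule for elements that need not be homogeneous. -/
theorem d_mul (A : DGAlgebra.{u, w} K) (a b : A) :
    A.d (a * b) = A.d a * b + A.koszul 1 a * A.d b := by
  induction a using A.induction with
  | h0 => simp
  | hadd a a' h h' => simp only [add_mul, map_add, h, h']; abel
  | hh m a ha => rw [A.leibniz m a b ha, A.koszul_apply 1 ha, one_mul, smul_mul_assoc]

theorem d_one (A : DGAlgebra.{u, w} K) : A.d 1 = 0 := by
  have h := A.leibniz 0 1 1 (SetLike.one_mem_graded _)
  simpa using h

/-! ### Cohomology -/

/-- The subalgebra of cocycles. -/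
def cocycles (A : DGAlgebra.{u, w} K) : Subalgebra K A where
  carrier := {a | A.d a = 0}
  mul_mem' {a b} ha hb := by
    simp only [Set.mem_ofPred_eq] at *
    rw [d_mul, ha, hb, zero_mul, mul_zero, add_zero]
  add_mem' {a b} ha hb := by
    simp only [Set.mem_ofPred_eq] at *
    rw [map_add, ha, hb, add_zero]
  algebraMap_mem' r := by
    simp only [Set.mem_ofPred_eq]
    rw [Algebra.algebraMap_eq_smul_one, map_smul, d_one, smul_zero]

theorem mem_cocycles (A : DGAlgebra.{u, w} K) {a : A} : a ∈ A.cocycles ↔ A.d a = 0 := Iff.rfl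

/-- The ideal of coboundaries in the algebra of cocycles. -/
def coboundaries (A : DGAlgebra.{u, w} K) : Ideal A.cocycles where
  carrier := {z | ∃ a : A, A.d a = z}
  add_mem' := by
    rintro _ _ ⟨a, ha⟩ ⟨b, hb⟩
    exact ⟨a + b, by rw [map_add, ha, hb]; rfl⟩
  zero_mem' := ⟨0, by simp⟩
  smul_mem' := by
    rintro z y ⟨a, ha⟩
    refine ⟨A.koszul 1 z * a, ?_⟩
    have hz : A.d z = 0 := z.2
    rw [d_mul, d_koszul, hz, koszul_koszul, koszul_add_self, ha]
    simp

theorem mem_coboundaries (A : DGAlgebra.{u, w} K) {z : A.cocycles} :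
    z ∈ A.coboundaries ↔ ∃ a : A, A.d a = z := Iff.rfl

instance (A : DGAlgebra.{u, w} K) : A.coboundaries.IsTwoSided where
  mul_mem_of_left := by
    rintro y z ⟨a, ha⟩
    refine ⟨a * z, ?_⟩
    have hz : A.d z = 0 := z.2
    rw [d_mul, hz, ha]
    simp

/-- The cohomology algebra `H(A) = ker d / im d` (the total space of the graded algebra). -/
abbrev Cohomology (A : DGAlgebra.{u, w} K) : Type w := A.cocycles ⧸ A.coboundaries

/-- The projection from cocycles to cohomology classes. -/
abbrev cohomologyClass (A : DGAlgebra.{u, w} K) : A.cocycles →ₐ[K] A.Cohomology :=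
  Ideal.Quotient.mkₐ K A.coboundaries

/-- `Hⁿ(A)`: the classes of cocycles of degree `n`. -/
def cohomologyGrading (A : DGAlgebra.{u, w} K) (n : ℤ) : Submodule K A.Cohomology :=
  ((A.grading n).comap A.cocycles.val.toLinearMap).map A.cohomologyClass.toLinearMap

theorem isInternal_of_proj {V : Type w} [AddCommGroup V] [Module K V] (M : ℤ → Submodule K V)
    (p : ℤ → V →ₗ[K] V) (h₁ : ∀ n, ∀ x ∈ M n, p n x = x)
    (h₂ : ∀ m n, m ≠ n → ∀ x ∈ M m, p n x = 0) (h₃ : ⨆ n, M n = ⊤) : DirectSum.IsInternal M := by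
  refine DirectSum.isInternal_submodule_of_iSupIndep_of_iSup_eq_top ?_ h₃
  intro n
  rw [Submodule.disjoint_def]
  intro x hx hx'
  rw [← h₁ n x hx]
  have : (⨆ j, ⨆ (_ : j ≠ n), M j) ≤ LinearMap.ker (p n) :=
    iSup₂_le fun j hj y hy => h₂ j n hj y hy
  exact this hx'

/-- The component of degree `n`, as a linear map. -/
noncomputable def proj (A : DGAlgebra.{u, w} K) (n : ℤ) : A →ₗ[K] A :=
  GradedAlgebra.proj A.grading n

theorem proj_same (A : DGAlgebra.{u, w} K) {n : ℤ} {a : A} (ha : a ∈ A.grading n) :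
    A.proj n a = a := DirectSum.decompose_of_mem_same _ ha

theorem proj_ne (A : DGAlgebra.{u, w} K) {m n : ℤ} (h : m ≠ n) {a : A} (ha : a ∈ A.grading m) :
    A.proj n a = 0 := DirectSum.decompose_of_mem_ne _ ha h

theorem proj_mem (A : DGAlgebra.{u, w} K) (n : ℤ) (a : A) : A.proj n a ∈ A.grading n :=
  SetLike.coe_mem _

theorem d_proj (A : DGAlgebra.{u, w} K) (n : ℤ) (a : A) :
    A.d (A.proj n a) = A.proj (n + 1) (A.d a) := by
  induction a using A.induction with
  | h0 => simp
  | hadd a a' h h' => simp [h, h']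
  | hh m a ha =>
    by_cases h : m = n
    · subst h
      rw [A.proj_same ha, A.proj_same (A.d_mem m a ha)]
    · rw [A.proj_ne h ha, A.proj_ne (by omega) (A.d_mem m a ha), map_zero]

theorem proj_cocycle (A : DGAlgebra.{u, w} K) (n : ℤ) {a : A} (ha : a ∈ A.cocycles) :
    A.proj n a ∈ A.cocycles := by
  rw [mem_cocycles] at *
  rw [d_proj, ha, map_zero]

/-- The projection of the cohomology to its degree `n` part. -/
noncomputable def cohomologyProj (A : DGAlgebra.{u, w} K) (n : ℤ) :
    A.Cohomology →ₗ[K] A.Cohomology :=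
  ((A.coboundaries).restrictScalars K).mapQ ((A.coboundaries).restrictScalars K)
    ((A.proj n).restrict (p := A.cocycles.toSubmodule) (q := A.cocycles.toSubmodule)
      (fun _ ha => A.proj_cocycle n ha)) (by
      rintro z ⟨a, ha⟩
      refine ⟨A.proj (n - 1) a, ?_⟩
      rw [d_proj, ha, sub_add_cancel]
      rfl)

theorem cohomologyProj_class (A : DGAlgebra.{u, w} K) (n : ℤ) (z : A.cocycles) :
    A.cohomologyProj n (A.cohomologyClass z) =
      A.cohomologyClass ⟨A.proj n z, A.proj_cocycle n z.2⟩ := rfl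

theorem cohomologyGrading_isInternal (A : DGAlgebra.{u, w} K) :
    DirectSum.IsInternal A.cohomologyGrading := by
  refine isInternal_of_proj _ A.cohomologyProj ?_ ?_ ?_
  · rintro n _ ⟨z, hz, rfl⟩
    refine (A.cohomologyProj_class n z).trans ?_
    exact congrArg _ (Subtype.ext (A.proj_same hz))
  · rintro m n hmn _ ⟨z, hz, rfl⟩
    refine (A.cohomologyProj_class n z).trans ?_
    rw [show (⟨A.proj n z, A.proj_cocycle n z.2⟩ : A.cocycles) = 0 from
      Subtype.ext (A.proj_ne hmn hz), map_zero]
  · rw [eq_top_iff]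
    rintro x -
    obtain ⟨z, rfl⟩ := Ideal.Quotient.mkₐ_surjective K _ x
    classical
    have hz : z = ∑ n ∈ (DirectSum.decompose A.grading (z : A)).support,
        (⟨A.proj n z, A.proj_cocycle n z.2⟩ : A.cocycles) := by
      apply Subtype.ext
      rw [AddSubmonoidClass.coe_finsetSum]
      exact (DirectSum.sum_support_decompose A.grading (z : A)).symm
    rw [hz, map_sum]
    refine Submodule.sum_mem _ fun n _ => Submodule.mem_iSup_of_mem n ?_
    exact ⟨_, A.proj_mem n z, rfl⟩

noncomputable instance (A : DGAlgebra.{u, w} K) : GradedAlgebra A.cohomologyGrading where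
  one_mem := ⟨1, SetLike.one_mem_graded A.grading, map_one A.cohomologyClass⟩
  mul_mem := by
    rintro m n _ _ ⟨y, hy, rfl⟩ ⟨z, hz, rfl⟩
    exact ⟨y * z, SetLike.mul_mem_graded (A := A.grading) hy hz, map_mul A.cohomologyClass y z⟩
  toDecomposition := A.cohomologyGrading_isInternal.chooseDecomposition

/-- The cohomology algebra as a differential graded algebra with zero differential. -/
noncomputable def cohomologyDGA (A : DGAlgebra.{u, w} K) : DGAlgebra.{u, w} K where
  carrier := A.Cohomology
  grading := A.cohomologyGrading
  d := 0
  d_mem _ _ _ := Submodule.zero_mem _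
  d_d _ := rfl
  leibniz := by simp

/-- The cohomology group `Hⁿ(A)`. -/
abbrev HGroup (A : DGAlgebra.{u, w} K) (n : ℤ) : Type w := A.cohomologyDGA.grading n

/-- The algebra homomorphism induced on cohomology. -/
def Hom.cohomologyMap {A : DGAlgebra.{u, v} K} {B : DGAlgebra.{u, w} K} (f : Hom A B) :
    A.Cohomology →ₐ[K] B.Cohomology :=
  Ideal.Quotient.liftₐ A.coboundaries
    (B.cohomologyClass.comp ((f.toAlgHom.comp A.cocycles.val).codRestrict B.cocycles
      (fun z => by
        have hz : A.d z = 0 := z.2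
        simp [mem_cocycles, ← f.map_d, hz])))
    (by
      rintro z ⟨a, ha⟩
      exact Ideal.Quotient.eq_zero_iff_mem.2 ⟨f.toAlgHom a, by rw [← f.map_d, ha]; rfl⟩)

/-- A quasi-isomorphism is a homomorphism that induces an isomorphism in cohomology. -/
def Hom.IsQuasiIso {A : DGAlgebra.{u, v} K} {B : DGAlgebra.{u, w} K} (f : Hom A B) : Prop :=
  Function.Bijective f.cohomologyMap

/-- The degree `t` part of the graded center of a differential graded algebra, regarded as a
graded algebra by forgetting the differential: the elements `z` of degree `t` with
`a z = (-1) ^ (|a| t) z a` for all homogeneous `a`. -/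
def gradedCenter (A : DGAlgebra.{u, w} K) (t : ℤ) : Submodule K A where
  carrier := {z | z ∈ A.grading t ∧
    ∀ (n : ℤ) (a : A), a ∈ A.grading n → a * z = (-1 : K) ^ (n * t) • (z * a)}
  zero_mem' := by simp
  add_mem' := by
    rintro y z ⟨hy, hy'⟩ ⟨hz, hz'⟩
    exact ⟨add_mem hy hz, fun n a ha => by
      rw [mul_add, add_mul, smul_add, hy' n a ha, hz' n a ha]⟩
  smul_mem' := by
    rintro c z ⟨hz, hz'⟩
    exact ⟨Submodule.smul_mem _ c hz, fun n a ha => by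
      rw [mul_smul_comm, smul_mul_assoc, hz' n a ha, smul_comm]⟩

theorem gradedCenter_le (A : DGAlgebra.{u, w} K) (t : ℤ) : A.gradedCenter t ≤ A.grading t :=
  fun _ h => h.1

end DGAlgebra

/-! ### The Hochschild complex -/

namespace DGAlgebra

variable {K : Type u} [Field K] (A : DGAlgebra.{u, w} K)

/-- Linear maps from the `s`-fold tensor power of `A` to `A`. -/
abbrev Multi (s : ℕ) : Type w := MultilinearMap K (fun _ : Fin s => A) A

/-- The usual additive group structure, restated in a form that instance search recognizes as an
extension of the usual additive monoid structure. -/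
instance (s : ℕ) : AddCommGroup (A.Multi s) :=
  { (inferInstance : AddCommMonoid (A.Multi s)), (inferInstance : AddCommGroup (A.Multi s)) with }

variable {A} {s : ℕ}

/-- `φ` is homogeneous of (cohomological) degree `t`, that is, `φ` lies in
`Hom(A ⊗ ⋯ ⊗ A, A)ᵗ`. -/
def IsHomogeneous (t : ℤ) (φ : A.Multi s) : Prop :=
  ∀ (n : Fin s → ℤ) (a : Fin s → A), (∀ i, a i ∈ A.grading (n i)) →
    φ a ∈ A.grading (∑ i, n i + t)

variable (A) in
/-- `slot i` acts on `a₁ ⊗ ⋯ ⊗ aₛ` as the differential in the `i`-th tensor factor, including the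
Koszul sign `(-1) ^ (|a₁| + ⋯ + |aᵢ₋₁|)` (recall that `koszul 1` is `a ↦ (-1) ^ |a| a`). -/
noncomputable def slot (i j : Fin s) : A →ₗ[K] A :=
  if j < i then A.koszul 1 else if j = i then A.d else LinearMap.id

/-- Precomposition with the differential of the `s`-fold tensor power of `A`. -/
noncomputable def precompD (φ : A.Multi s) : A.Multi s :=
  ∑ i : Fin s, φ.compLinearMap (A.slot i)

/-- The differential of the complex `Hom(A ⊗ ⋯ ⊗ A, A)` on elements `φ` of degree `t`:
`φ ↦ d ∘ φ - (-1)ᵗ φ ∘ d`. -/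
noncomputable def internalD (t : ℤ) (φ : A.Multi s) : A.Multi s :=
  A.d.compMultilinearMap φ - (-1 : K) ^ t • precompD φ

/-- The first coface `a₀, …, aₛ ↦ (-1) ^ (t |a₀|) a₀ φ(a₁, …, aₛ)`, for `φ` of degree `t`. -/
noncomputable def firstFace (t : ℤ) (φ : A.Multi s) : A.Multi (s + 1) :=
  LinearMap.uncurryLeft (M := fun _ : Fin (s + 1) => A)
    { toFun := fun a => (LinearMap.mulLeft K (A.koszul t a)).compMultilinearMap φ
      map_add' := fun a b => by ext; simp [add_mul]
      map_smul' := fun c a => by ext; simp }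

theorem contractNth_update (i : Fin s) (a : Fin (s + 1) → A) (k : Fin (s + 1)) (x : A) :
    i.castSucc.contractNth (· * ·) (Function.update a k x) =
      Function.update (i.castSucc.contractNth (· * ·) a) (i.predAbove k)
        (if k < i.castSucc then x else if k = i.castSucc then x * a i.succ
          else if k = i.succ then a i.castSucc * x else x) := by
  funext l
  have hk : ((i.predAbove k : Fin s) : ℕ) = if (i : ℕ) < k then (k : ℕ) - 1 else k := by
    unfold Fin.predAbove
    simp only [Fin.lt_def, Fin.val_castSucc]
    split_ifs <;> simp
  have hl : l = i.predAbove k ↔ (l : ℕ) = if (i : ℕ) < k then (k : ℕ) - 1 else k := by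
    rw [Fin.ext_iff, hk]
  simp only [Fin.contractNth, Function.update_apply, hl, Fin.ext_iff, Fin.lt_def,
    Fin.val_castSucc, Fin.val_succ]
  have h1 : (l : ℕ) = i → l = i := fun h => Fin.ext h
  split_ifs <;> first | rfl | omega | (rw [h1 (by omega)])

/-- The inner cofaces `a₀, …, aₛ ↦ φ(a₀, …, aᵢ aᵢ₊₁, …, aₛ)`. -/
def midFace (i : Fin s) (φ : A.Multi s) : A.Multi (s + 1) :=
  MultilinearMap.mk' (fun a => φ (i.castSucc.contractNth (· * ·) a))
    (fun a k x y => by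
      simp only [contractNth_update]
      split_ifs <;> simp [mul_add, add_mul])
    (fun a k c x => by
      simp only [contractNth_update]
      split_ifs <;> simp)

/-- The last coface `a₀, …, aₛ ↦ φ(a₀, …, aₛ₋₁) aₛ`. -/
noncomputable def lastFace (φ : A.Multi s) : A.Multi (s + 1) :=
  MultilinearMap.uncurryRight (M := fun _ : Fin (s + 1) => A)
    ((LinearMap.mul K A).compMultilinearMap φ)

/-- The Hochschild differential on elements `φ` of degree `t`: the alternating sum of the
cofaces. -/
noncomputable def hochschildD (t : ℤ) (φ : A.Multi s) : A.Multi (s + 1) :=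
  firstFace t φ + ∑ i : Fin s, (-1 : K) ^ ((i : ℕ) + 1) • midFace i φ +
    (-1 : K) ^ (s + 1) • lastFace φ

theorem precompD_apply (φ : A.Multi s) (a : Fin s → A) :
    precompD φ a = ∑ i, φ (fun j => A.slot i j (a j)) := by
  simp [precompD]

theorem firstFace_apply (t : ℤ) (φ : A.Multi s) (a : Fin (s + 1) → A) :
    firstFace t φ a = A.koszul t (a 0) * φ (fun i => a i.succ) := rfl

theorem midFace_apply (i : Fin s) (φ : A.Multi s) (a : Fin (s + 1) → A) :
    midFace i φ a = φ (i.castSucc.contractNth (· * ·) a) := rfl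

theorem lastFace_apply (φ : A.Multi s) (a : Fin (s + 1) → A) :
    lastFace φ a = φ (fun i => a i.castSucc) * a (Fin.last s) := rfl

theorem internalD_apply (t : ℤ) (φ : A.Multi s) (a : Fin s → A) :
    internalD t φ a = A.d (φ a) - (-1 : K) ^ t • ∑ i, φ (fun j => A.slot i j (a j)) := by
  simp [internalD, precompD_apply]

theorem hochschildD_apply (t : ℤ) (φ : A.Multi s) (a : Fin (s + 1) → A) :
    hochschildD t φ a = A.koszul t (a 0) * φ (fun i => a i.succ) +
      ∑ i : Fin s, (-1 : K) ^ ((i : ℕ) + 1) • φ (i.castSucc.contractNth (· * ·) a) +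
      (-1 : K) ^ (s + 1) • (φ (fun i => a i.castSucc) * a (Fin.last s)) := by
  simp [hochschildD, firstFace_apply, midFace_apply, lastFace_apply]

theorem internalD_add (t : ℤ) (φ ψ : A.Multi s) :
    internalD t (φ + ψ) = internalD t φ + internalD t ψ := by
  ext a
  simp only [internalD_apply, add_apply, map_add, Finset.sum_add_distrib, smul_add]
  abel

theorem internalD_smul (t : ℤ) (c : K) (φ : A.Multi s) :
    internalD t (c • φ) = c • internalD t φ := by
  ext a
  simp only [internalD_apply, smul_apply, map_smul, ← Finset.smul_sum, smul_sub,
    smul_comm c]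

theorem hochschildD_add (t : ℤ) (φ ψ : A.Multi s) :
    hochschildD t (φ + ψ) = hochschildD t φ + hochschildD t ψ := by
  ext a
  simp only [hochschildD_apply, add_apply, Finset.sum_add_distrib, smul_add,
    mul_add, add_mul]
  abel

theorem hochschildD_smul (t : ℤ) (c : K) (φ : A.Multi s) :
    hochschildD t (c • φ) = c • hochschildD t φ := by
  ext a
  simp only [hochschildD_apply, smul_apply, Finset.smul_sum, smul_add,
    mul_smul_comm, smul_mul_assoc, smul_comm c]

/-! The two differentials have degree one. -/

theorem slot_mem (i j : Fin s) {n : Fin s → ℤ} {a : A} (ha : a ∈ A.grading (n j)) :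
    A.slot i j a ∈ A.grading ((n + Pi.single i 1 : Fin s → ℤ) j) := by
  unfold slot
  split_ifs with h h'
  · simpa [h.ne] using A.koszul_mem 1 ha
  · subst h'; simpa using A.d_mem _ _ ha
  · simpa [h'] using ha

theorem IsHomogeneous.internalD {t : ℤ} {φ : A.Multi s} (h : IsHomogeneous t φ) :
    IsHomogeneous (t + 1) (internalD t φ) := by
  intro n a ha
  rw [internalD_apply]
  refine sub_mem ?_ (Submodule.smul_mem _ _ (Submodule.sum_mem _ fun i _ => ?_))
  · have := A.d_mem _ _ (h n a ha)
    rwa [add_assoc] at this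
  · have := h _ _ (fun j => slot_mem i j (ha j))
    simp only [Pi.add_apply, Finset.sum_add_distrib, Finset.sum_pi_single', Finset.mem_univ,
      if_true] at this
    convert this using 2
    ring

theorem sum_contractNth (i : Fin s) (n : Fin (s + 1) → ℤ) :
    ∑ j, i.castSucc.contractNth (· + ·) n j = ∑ j, n j := by
  rw [Fin.sum_univ_succAbove n i.castSucc, ← sub_eq_iff_eq_add, ← Finset.sum_sub_distrib,
    Finset.sum_eq_single i]
  · simp [Fin.contractNth]
  · intro j _ hj
    rw [Fin.contractNth_apply_of_ne _ _ _ _ (by simpa [Fin.ext_iff, eq_comm] using hj), sub_self]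
  · simp

theorem IsHomogeneous.hochschildD {t : ℤ} {φ : A.Multi s} (h : IsHomogeneous t φ) :
    IsHomogeneous t (hochschildD t φ) := by
  intro n a ha
  rw [hochschildD_apply]
  refine add_mem (add_mem ?_ (Submodule.sum_mem _ fun i _ => Submodule.smul_mem _ _ ?_))
    (Submodule.smul_mem _ _ ?_)
  · have := SetLike.mul_mem_graded (A.koszul_mem t (ha 0)) (h _ _ fun i => ha i.succ)
    rwa [Fin.sum_univ_succ, add_assoc]
  · rw [← sum_contractNth i]
    refine h _ _ fun j => ?_
    unfold Fin.contractNth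
    split_ifs
    · exact ha _
    · exact SetLike.mul_mem_graded (ha _) (ha _)
    · exact ha _
  · have := SetLike.mul_mem_graded (h _ _ fun i => ha i.castSucc) (ha (Fin.last s))
    rwa [Fin.sum_univ_castSucc, add_right_comm]
end DGAlgebra

/-! ### The total differential squares to zero -/

namespace DGAlgebra

variable {K : Type u} [Field K] {A : DGAlgebra.{u, w} K} {s : ℕ}

theorem alternating_sum_eq_zero {V : Type w} [AddCommGroup V] [Module K V] (m : ℕ)
    (F : ℕ → ℕ → V) (h : ∀ i j, j < i → i ≤ m + 1 → F i j = F j (i - 1)) :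
    ∑ i ∈ Finset.range (m + 2), ∑ j ∈ Finset.range (m + 1),
      ((-1 : K) ^ i * (-1 : K) ^ j) • F i j = 0 := by
  rw [← Finset.sum_product']
  refine Finset.sum_involution
    (fun p _ => if p.2 < p.1 then (p.2, p.1 - 1) else (p.2 + 1, p.1)) ?_ ?_ ?_ ?_
  · rintro ⟨i, j⟩ hp
    simp only [Finset.mem_product, Finset.mem_range] at hp
    dsimp only
    split_ifs with hij
    · dsimp only
      rw [h i j hij (by omega)]
      obtain ⟨i, rfl⟩ : ∃ k, i = k + 1 := ⟨i - 1, by omega⟩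
      rw [← add_smul, Nat.add_sub_cancel, pow_succ]
      convert zero_smul K _
      ring
    · dsimp only
      rw [h (j + 1) i (by omega) (by omega), Nat.add_sub_cancel, ← add_smul, pow_succ]
      convert zero_smul K _
      ring
  · rintro ⟨i, j⟩ hp _
    dsimp only
    split_ifs with hij <;> simp only [ne_eq, Prod.mk.injEq] <;> omega
  · rintro ⟨i, j⟩ hp
    simp only [Finset.mem_product, Finset.mem_range] at hp ⊢
    split_ifs with hij <;> dsimp only <;> omega
  · rintro ⟨i, j⟩ hp
    by_cases hij : j < i
    · simp only [hij, if_true, show ¬ i - 1 < j by omega, if_false]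
      exact Prod.ext (by dsimp only; omega) rfl
    · simp only [hij, if_false, show i < j + 1 by omega, if_true]
      exact Prod.ext rfl (by dsimp only; omega)

/-- All the cofaces, with a uniform numbering. -/
noncomputable def coface (t : ℤ) (i : ℕ) (φ : A.Multi s) : A.Multi (s + 1) :=
  if i = 0 then firstFace t φ else if h : i - 1 < s then midFace ⟨i - 1, h⟩ φ else lastFace φ

theorem hochschildD_eq (t : ℤ) (φ : A.Multi s) :
    hochschildD t φ = ∑ i ∈ Finset.range (s + 2), (-1 : K) ^ i • coface t i φ := by
  rw [Finset.sum_range_succ, Finset.sum_range_succ', hochschildD, ← Fin.sum_univ_eq_sum_range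
    (fun i => (-1 : K) ^ (i + 1) • coface t (i + 1) φ)]
  simp [coface, add_comm]

theorem coface_hochschildD (t : ℤ) (i : ℕ) (φ : A.Multi s) (a : Fin (s + 2) → A) :
    coface t i (hochschildD t φ) a =
      ∑ j ∈ Finset.range (s + 2), (-1 : K) ^ j • coface t i (coface t j φ) a := by
  rw [hochschildD_eq]
  unfold coface
  split_ifs
  · simp only [firstFace_apply, sum_apply, Finset.mul_sum, smul_apply, mul_smul_comm]
  · simp only [midFace_apply, sum_apply, smul_apply]
  · simp only [lastFace_apply, sum_apply, Finset.sum_mul, smul_apply, smul_mul_assoc]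

theorem coface_coface (t : ℤ) (i j : ℕ) (hij : j < i) (hi : i ≤ s + 2) (φ : A.Multi s)
    (a : Fin (s + 2) → A) :
    coface t i (coface t j φ) a = coface t j (coface t (i - 1) φ) a := by
  obtain ⟨i, rfl⟩ : ∃ k, i = k + 1 := ⟨i - 1, by omega⟩
  rcases j with _ | j
  · rcases i with _ | i
    · simp only [coface, if_true, zero_add, Nat.sub_self, one_ne_zero, if_false,
        Nat.zero_lt_succ, dif_pos, midFace_apply, firstFace_apply]
      rw [← mul_assoc, ← koszul_mul]
      rfl
    · by_cases hs : i < s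
      · simp only [coface, if_true, Nat.add_sub_cancel, Nat.succ_ne_zero, if_false, hs,
          Nat.add_lt_add_iff_right, dif_pos, midFace_apply, firstFace_apply]
        congr 2
        funext k
        simp only [Fin.contractNth, Fin.val_succ, Fin.val_castSucc, Nat.add_lt_add_iff_right,
          Nat.add_right_cancel_iff]
        rfl
      · simp only [coface, if_true, Nat.add_sub_cancel, Nat.succ_ne_zero, if_false, hs,
          Nat.add_lt_add_iff_right, dif_neg, not_false_eq_true, lastFace_apply, firstFace_apply,
          ← mul_assoc]
        rfl
  · by_cases hi' : i < s + 1
    · have hj : j < s := by omega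
      obtain ⟨i, rfl⟩ : ∃ k, i = k + 1 := ⟨i - 1, by omega⟩
      have hi'' : i < s := by omega
      simp only [coface, Nat.add_sub_cancel, Nat.succ_ne_zero, if_false, hj, hi', hi'',
        show j < s + 1 by omega, dif_pos, midFace_apply]
      congr 1
      funext k
      simp only [Fin.contractNth, Fin.val_succ, Fin.val_castSucc]
      split_ifs <;> first | rfl | omega | exact (mul_assoc _ _ _).symm
    · by_cases hj : j < s
      · simp only [coface, Nat.add_sub_cancel, Nat.succ_ne_zero, if_false, hj, hi',
          show j < s + 1 by omega, show ¬ i - 1 < s by omega, show i ≠ 0 by omega, dif_pos,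
          dif_neg, not_false_eq_true, midFace_apply, lastFace_apply]
        congr 2
        simp only [Fin.contractNth, Fin.val_last, Fin.val_castSucc, show ¬ s < j by omega,
          show s ≠ j by omega, if_false]
        rfl
      · have hj' : j = s := by omega
        subst hj'
        simp only [coface, Nat.add_sub_cancel, Nat.succ_ne_zero, if_false, hi',
          show j < j + 1 by omega, show ¬ i - 1 < j by omega, show i ≠ 0 by omega, dif_pos,
          lt_irrefl, dif_neg, not_false_eq_true, midFace_apply, lastFace_apply]
        rw [mul_assoc]
        congr 1
        · congr 1
          funext k
          simp [Fin.contractNth]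
        · simp [Fin.contractNth]

theorem hochschildD_hochschildD (t : ℤ) (φ : A.Multi s) :
    hochschildD t (hochschildD t φ) = 0 := by
  ext a
  rw [hochschildD_eq t (hochschildD t φ)]
  simp only [sum_apply, smul_apply, coface_hochschildD, Finset.smul_sum, smul_smul, zero_apply]
  exact alternating_sum_eq_zero (s + 1) (fun i j => coface t i (coface t j φ) a)
    fun i j hij hi => coface_coface t i j hij hi φ a

theorem slot_koszul (i j : Fin s) (a : A) (h : j ≤ i) :
    A.slot i j (A.koszul 1 a) = (if j = i then (-1 : K) else 1) • A.koszul 1 (A.slot i j a) := by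
  unfold slot
  split_ifs with h1 h2 h3
  · exact absurd h2 h1.ne
  · simp
  · simp [d_koszul]
  · exact absurd (lt_of_le_of_ne h h3) h1

theorem slot_slot (i j : Fin s) (φ : A.Multi s) (a : Fin s → A) (hij : i < j) :
    φ (fun k => A.slot i k (A.slot j k (a k))) = -φ (fun k => A.slot j k (A.slot i k (a k))) := by
  have h : (fun k => A.slot i k (A.slot j k (a k))) =
      Function.update (fun k => A.slot j k (A.slot i k (a k))) i
        ((-1 : K) • A.slot j i (A.slot i i (a i))) := by
    funext k
    by_cases hk : k = i
    · subst hk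
      simp [slot, hij, d_koszul]
    · rw [Function.update_of_ne hk]
      unfold slot
      split_ifs <;> first | rfl | (exfalso; omega)
  rw [h, MultilinearMap.map_update_smul, Function.update_eq_self, neg_one_smul]

theorem precompD_precompD (φ : A.Multi s) : precompD (precompD φ) = 0 := by
  ext a
  simp only [precompD_apply, zero_apply]
  have h : ∀ i j : Fin s, φ (fun k => A.slot j k (A.slot i k (a k))) =
      -φ (fun k => A.slot i k (A.slot j k (a k))) := by
    intro i j
    rcases lt_trichotomy i j with hij | hij | hij
    · rw [slot_slot i j φ a hij, neg_neg]
    · subst hij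
      have h0 : φ (fun k => A.slot i k (A.slot i k (a k))) = 0 :=
        φ.map_coord_zero i (by simp [slot, d_d])
      rw [h0, neg_zero]
    · exact slot_slot j i φ a hij
  have h0 : ∀ i : Fin s, φ (fun k => A.slot i k (A.slot i k (a k))) = 0 := fun i =>
    φ.map_coord_zero i (by simp [slot, d_d])
  rw [← Finset.sum_product']
  refine Finset.sum_involution (fun p _ => (p.2, p.1)) ?_ ?_ ?_ ?_
  · rintro ⟨i, j⟩ _
    dsimp only
    rw [h i j, neg_add_cancel]
  · rintro ⟨i, j⟩ _ hne heq
    simp only [Prod.mk.injEq] at heq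
    obtain ⟨rfl, -⟩ := heq
    exact hne (h0 _)
  · simp
  · simp

theorem precompD_comp (φ : A.Multi s) :
    precompD (A.d.compMultilinearMap φ) = A.d.compMultilinearMap (precompD φ) := by
  ext a; simp [precompD_apply]

theorem precompD_sub (φ ψ : A.Multi s) : precompD (φ - ψ) = precompD φ - precompD ψ := by
  ext a; simp [precompD_apply]

theorem precompD_smul (c : K) (φ : A.Multi s) : precompD (c • φ) = c • precompD φ := by
  ext a; simp [precompD_apply, Finset.smul_sum]

theorem internalD_internalD (t : ℤ) (φ : A.Multi s) :
    internalD (t + 1) (internalD t φ) = 0 := by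
  have h : A.d.compMultilinearMap (A.d.compMultilinearMap φ) = 0 := by
    ext a; simp [d_d]
  unfold internalD
  rw [precompD_sub, precompD_smul, precompD_precompD, precompD_comp, zpow_add₀ (by simp)]
  ext a
  simp [d_d]

theorem multi_ext {f g : A.Multi s} (h : ∀ (n : Fin s → ℤ) (a : Fin s → A),
    (∀ i, a i ∈ A.grading (n i)) → f a = g a) : f = g := by
  have key : ∀ (S : Finset (Fin s)) (a : Fin s → A),
      (∀ i ∉ S, ∃ n, a i ∈ A.grading n) → f a = g a := by
    intro S
    induction S using Finset.induction_on with
    | empty =>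
      intro a ha
      choose n hn using fun i => ha i (Finset.notMem_empty i)
      exact h n a hn
    | insert i S _ ih =>
      intro a ha
      rw [← Function.update_eq_self i a]
      generalize a i = x
      induction x using A.induction with
      | h0 => rw [f.map_update_zero, g.map_update_zero]
      | hadd x y hx hy => rw [f.map_update_add, g.map_update_add, hx, hy]
      | hh n x hx =>
        refine ih _ fun j hj => ?_
        by_cases hji : j = i
        · subst hji; exact ⟨n, by simpa using hx⟩
        · rw [Function.update_of_ne hji]
          exact ha j (by simp [hji, hj])
  ext a
  exact key Finset.univ a (by simp)

/-- Homogeneous multilinear maps are compatible with the parity automorphism up to sign. -/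
theorem IsHomogeneous.koszul {t : ℤ} {φ : A.Multi s} (h : IsHomogeneous t φ) (a : Fin s → A) :
    A.koszul 1 (φ a) = (-1 : K) ^ t • φ (fun i => A.koszul 1 (a i)) := by
  have key : (A.koszul 1).compMultilinearMap φ =
      (-1 : K) ^ t • φ.compLinearMap (fun _ => A.koszul 1) := by
    refine multi_ext fun n a ha => ?_
    have hprod : ∀ S : Finset (Fin s), ∏ i ∈ S, (-1 : K) ^ n i = (-1 : K) ^ ∑ i ∈ S, n i := by
      intro S
      induction S using Finset.induction_on with
      | empty => simp
      | insert i S hi ih => rw [Finset.prod_insert hi, Finset.sum_insert hi, ih,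
          zpow_add₀ (by simp)]
    simp only [LinearMap.compMultilinearMap_apply, smul_apply,
      MultilinearMap.compLinearMap_apply]
    rw [A.koszul_apply 1 (h n a ha)]
    simp only [A.koszul_apply 1 (ha _), one_mul]
    rw [φ.map_smul_univ, hprod, smul_smul, ← zpow_add₀ (by simp), add_comm]
  exact DFunLike.congr_fun key a

theorem slot_contractNth (i : Fin s) (φ : A.Multi s) (a : Fin (s + 1) → A) :
    ∑ l : Fin (s + 1), φ (i.castSucc.contractNth (· * ·) (fun k => A.slot l k (a k))) =
      ∑ l : Fin s, φ (fun k => A.slot l k (i.castSucc.contractNth (· * ·) a k)) := by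
  rw [Fin.sum_univ_succAbove _ i.castSucc, ← eq_sub_iff_add_eq, ← Finset.sum_sub_distrib,
    Finset.sum_eq_single i]
  · rw [eq_sub_iff_add_eq, Fin.succAbove_castSucc_self]
    have h : ∀ (l : Fin (s + 1)) (x : A), (l = i.castSucc ∨ l = i.succ) →
        x = A.slot l i.castSucc (a i.castSucc) * A.slot l i.succ (a i.succ) →
        i.castSucc.contractNth (· * ·) (fun k => A.slot l k (a k)) =
          Function.update (fun k => A.slot i k (i.castSucc.contractNth (· * ·) a k)) i x := by
      rintro l x hl rfl
      have hl' : (l : ℕ) = i ∨ (l : ℕ) = i + 1 := hl.imp (fun h => by simp [h]) (fun h => by simp [h])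
      funext k
      by_cases hk : k = i
      · subst hk; simp [Fin.contractNth]
      · rw [Function.update_of_ne hk]
        have hk' : (k : ℕ) ≠ i := fun h => hk (Fin.ext h)
        simp only [Fin.contractNth, Fin.val_castSucc, hk', if_false, slot, Fin.lt_def, Fin.ext_iff,
          Fin.val_succ]
        split_ifs <;> first | rfl | (exfalso; omega)
    rw [h _ _ (Or.inl rfl) rfl, h _ _ (Or.inr rfl) rfl, ← φ.map_update_add]
    congr 1
    conv_rhs => rw [← Function.update_eq_self i
      (fun k => A.slot i k (i.castSucc.contractNth (· * ·) a k))]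
    congr 1
    simp [slot, Fin.contractNth, d_mul, Fin.lt_def, Fin.ext_iff]
  · intro l _ hl
    have hl' : (l : ℕ) ≠ i := fun h => hl (Fin.ext h)
    rw [sub_eq_zero]
    congr 1
    funext k
    have hk : k = i ↔ (k : ℕ) = i := Fin.ext_iff
    rcases lt_or_gt_of_ne hl' with h | h
    · rw [Fin.succAbove_of_castSucc_lt _ _ (show (l : ℕ) < i from h)]
      simp only [Fin.contractNth, Fin.val_castSucc, slot, Fin.lt_def, Fin.ext_iff, Fin.val_succ]
      split_ifs <;> first | rfl | (exfalso; omega)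
    · rw [Fin.succAbove_of_le_castSucc _ _ (show (i : ℕ) ≤ l from h.le)]
      simp only [Fin.contractNth, Fin.val_castSucc, slot, Fin.lt_def, Fin.ext_iff, Fin.val_succ]
      split_ifs <;> first | rfl | (exfalso; omega) | exact koszul_mul _ _ _ _
  · simp

theorem firstFace_internalD (t : ℤ) (φ : A.Multi s) :
    firstFace (t + 1) (internalD t φ) = internalD t (firstFace t φ) := by
  ext a
  have h0 : A.koszul t (A.koszul 1 (a 0)) = A.koszul (t + 1) (a 0) := A.koszul_koszul t 1 _
  have h1 : A.koszul 1 (A.koszul t (a 0)) = A.koszul (t + 1) (a 0) := by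
    rw [koszul_koszul, add_comm]
  have h2 : ∀ i : Fin s, (fun j : Fin s => A.slot i.succ j.succ (a j.succ)) =
      fun j => A.slot i j (a j.succ) := by
    intro i; funext j; simp [slot]
  have h3 : (fun j : Fin s => A.slot 0 j.succ (a j.succ)) = fun j => a j.succ := by
    funext j; simp [slot, Fin.ext_iff]
  have h4 : A.slot (0 : Fin (s + 1)) 0 = A.d := by simp [slot]
  have h5 : ∀ i : Fin s, A.slot i.succ 0 = A.koszul 1 := by intro i; simp [slot]
  simp only [firstFace_apply, internalD_apply, Fin.sum_univ_succ, h2, h3, h4, h5, h0, d_mul, h1,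
    d_koszul, ← Finset.mul_sum, smul_add, smul_mul_assoc, mul_sub, mul_smul_comm]
  abel

theorem midFace_internalD (t : ℤ) (i : Fin s) (φ : A.Multi s) :
    midFace i (internalD t φ) = internalD t (midFace i φ) := by
  ext a
  simp only [midFace_apply, internalD_apply, slot_contractNth]

theorem lastFace_internalD {t : ℤ} {φ : A.Multi s} (h : IsHomogeneous t φ) :
    lastFace (internalD t φ) = internalD t (lastFace φ) := by
  ext a
  have h2 : ∀ i : Fin s, (fun j : Fin s => A.slot i.castSucc j.castSucc (a j.castSucc)) =
      fun j => A.slot i j (a j.castSucc) := by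
    intro i; funext j; simp [slot]
  have h3 : (fun j : Fin s => A.slot (Fin.last s) j.castSucc (a j.castSucc)) =
      fun j => A.koszul 1 (a j.castSucc) := by
    funext j; simp [slot, Fin.castSucc_lt_last]
  have h4 : A.slot (Fin.last s) (Fin.last s) = A.d := by simp [slot]
  have h5 : ∀ i : Fin s, A.slot i.castSucc (Fin.last s) = LinearMap.id := by
    intro i
    simp [slot, Fin.ext_iff, Fin.lt_def, i.2.ne', i.2.le]
  simp only [lastFace_apply, internalD_apply, Fin.sum_univ_castSucc, h2, h3, h4, h5, d_mul,
    h.koszul, ← Finset.sum_mul, smul_add, smul_mul_assoc, sub_mul, LinearMap.id_apply]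
  abel

theorem internalD_sum {ι : Type*} (t : ℤ) (S : Finset ι) (f : ι → A.Multi s) :
    internalD t (∑ i ∈ S, f i) = ∑ i ∈ S, internalD t (f i) :=
  map_sum (AddMonoidHom.mk' (internalD t) (internalD_add t)) f S

theorem hochschildD_internalD {t : ℤ} {φ : A.Multi s} (h : IsHomogeneous t φ) :
    hochschildD (t + 1) (internalD t φ) = internalD t (hochschildD t φ) := by
  simp only [hochschildD, internalD_add, internalD_sum, internalD_smul, firstFace_internalD,
    midFace_internalD, lastFace_internalD h]

end DGAlgebra

/-! ### Hochschild cohomology and the characteristic spectral sequence -/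

namespace DGAlgebra

variable {K : Type u} [Field K] (A : DGAlgebra.{u, w} K)

/-- The degree `n` part of the Hochschild complex, that is, of the product total complex of the
bicomplex `E_0^{s,t} = Hom(A ⊗ ⋯ ⊗ A, A)ᵗ` with `s` tensor factors: the families `(φₛ)` with `φₛ` of bidegree `(s, n - s)`. -/
def hochschildCochains (n : ℤ) : Submodule K (∀ s : ℕ, A.Multi s) where
  carrier := {φ | ∀ s : ℕ, IsHomogeneous (n - s) (φ s)}
  zero_mem' _ _ _ _ := Submodule.zero_mem _
  add_mem' hφ hψ s m a ha := add_mem (hφ s m a ha) (hψ s m a ha)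
  smul_mem' c _ hφ s m a ha := Submodule.smul_mem _ c (hφ s m a ha)

/-- The total differential on Hochschild cochains of total degree `n`: the sum of the Hochschild
differential and of `(-1)ˢ` times the internal differential in column `s`. -/
noncomputable def totalD (n : ℤ) : (∀ s : ℕ, A.Multi s) →ₗ[K] (∀ s : ℕ, A.Multi s) where
  toFun φ
    | 0 => internalD n (φ 0)
    | s + 1 => (-1 : K) ^ (s + 1) • internalD (n - (s + 1 : ℕ)) (φ (s + 1)) +
        hochschildD (n - s) (φ s)
  map_add' φ ψ := by
    funext s
    cases s with
    | zero => exact internalD_add _ _ _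
    | succ s =>
      simp only [Pi.add_apply, internalD_add, hochschildD_add, smul_add]
      abel
  map_smul' c φ := by
    funext s
    cases s with
    | zero => exact internalD_smul _ _ _
    | succ s =>
      simp only [Pi.smul_apply, internalD_smul, hochschildD_smul, smul_add, RingHom.id_apply,
        smul_comm c]

variable {A}

theorem totalD_zero_apply (n : ℤ) (φ : ∀ s : ℕ, A.Multi s) :
    A.totalD n φ 0 = internalD n (φ 0) := rfl

theorem totalD_succ_apply (n : ℤ) (φ : ∀ s : ℕ, A.Multi s) (s : ℕ) :
    A.totalD n φ (s + 1) = (-1 : K) ^ (s + 1) • internalD (n - (s + 1 : ℕ)) (φ (s + 1)) +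
      hochschildD (n - s) (φ s) := rfl

theorem totalD_mem {n : ℤ} {φ : ∀ s : ℕ, A.Multi s} (h : φ ∈ A.hochschildCochains n) :
    A.totalD n φ ∈ A.hochschildCochains (n + 1) := by
  intro s
  cases s with
  | zero =>
    have := (h 0).internalD
    simpa [totalD_zero_apply] using this
  | succ s =>
    rw [totalD_succ_apply]
    intro m a ha
    refine add_mem (Submodule.smul_mem _ _ ?_) ?_
    · have := (h (s + 1)).internalD m a ha
      rwa [sub_add_eq_add_sub] at this
    · have := (h s).hochschildD m a ha
      rwa [show n - (s : ℤ) = n + 1 - (s + 1 : ℕ) by push_cast; ring] at this ⊢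

/-- The Hochschild complex is a complex. -/
theorem totalD_totalD {n : ℤ} {φ : ∀ s : ℕ, A.Multi s} (h : φ ∈ A.hochschildCochains n) :
    A.totalD (n + 1) (A.totalD n φ) = 0 := by
  funext s
  rcases s with _ | _ | s
  · exact internalD_internalD n (φ 0)
  · have h0 := hochschildD_internalD (h 0)
    have h1 := internalD_internalD (n - (0 + 1 : ℕ)) (φ 1)
    simp only [totalD_succ_apply, totalD_zero_apply, internalD_add, internalD_smul] at *
    simp only [Nat.cast_zero, sub_zero, zero_add, Nat.cast_one, sub_add_cancel,
      add_sub_cancel_right, pow_one, neg_smul, one_smul] at *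
    rw [h0, h1]
    simp
  · have h0 := hochschildD_internalD (h (s + 1))
    have h1 := internalD_internalD (n - (s + 1 + 1 : ℕ)) (φ (s + 1 + 1))
    have h2 := hochschildD_hochschildD (n - s) (φ s)
    simp only [totalD_succ_apply, internalD_add, internalD_smul, hochschildD_add,
      hochschildD_smul, Pi.zero_apply] at *
    rw [show n - ((s + 1 + 1 : ℕ) : ℤ) + 1 = n + 1 - (s + 1 + 1 : ℕ) by ring] at h1
    rw [show n - ((s + 1 : ℕ) : ℤ) + 1 = n + 1 - (s + 1 : ℕ) by ring] at h0
    rw [h0, h1, show n + 1 - ((s + 1 + 1 : ℕ) : ℤ) = n - (s + 1 : ℕ) by push_cast; ring,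
      show n + 1 - ((s + 1 : ℕ) : ℤ) = n - s by push_cast; ring, h2, pow_succ]
    simp

variable (A)

/-- Hochschild cocycles of degree `n`. -/
noncomputable def hochschildCocycles (n : ℤ) : Submodule K (∀ s : ℕ, A.Multi s) :=
  A.hochschildCochains n ⊓ LinearMap.ker (A.totalD n)

/-- Hochschild coboundaries of degree `n`. -/
noncomputable def hochschildCoboundaries (n : ℤ) : Submodule K (∀ s : ℕ, A.Multi s) :=
  (A.hochschildCochains (n - 1)).map (A.totalD (n - 1))

theorem hochschildCoboundaries_le (n : ℤ) :
    A.hochschildCoboundaries n ≤ A.hochschildCocycles n := by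
  rintro _ ⟨φ, hφ, rfl⟩
  have h1 := totalD_mem hφ
  have h2 := totalD_totalD hφ
  rw [sub_add_cancel] at h1 h2
  exact ⟨h1, h2⟩

/-- The Hochschild cohomology `HHⁿ(A)` of a differential graded algebra, with coefficients in
`A`. -/
abbrev HH (n : ℤ) : Type w :=
  A.hochschildCocycles n ⧸ (A.hochschildCoboundaries n).submoduleOf (A.hochschildCocycles n)

/-- The filtration of the Hochschild complex by columns. -/
def columnFiltration (p : ℤ) : Submodule K (∀ s : ℕ, A.Multi s) where
  carrier := {φ | ∀ s : ℕ, (s : ℤ) < p → φ s = 0}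
  zero_mem' _ _ := rfl
  add_mem' hφ hψ s hs := by rw [Pi.add_apply, hφ s hs, hψ s hs, add_zero]
  smul_mem' c _ hφ s hs := by rw [Pi.smul_apply, hφ s hs, smul_zero]

/-- The elements of filtration `p` and total degree `p + q` whose differential has filtration
`p + r`, usually denoted by `Z_r^{p,q}`. -/
noncomputable def pageCycles (r p q : ℤ) : Submodule K (∀ s : ℕ, A.Multi s) :=
  A.hochschildCochains (p + q) ⊓ A.columnFiltration p ⊓
    (A.columnFiltration (p + r)).comap (A.totalD (p + q))

/-- The sum `Z_{r-1}^{p+1,q-1} + d Z_{r-1}^{p-r+1,q+r-2}`, in total degree `p + q`. -/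
noncomputable def pageBoundaries (r p q : ℤ) : Submodule K (∀ s : ℕ, A.Multi s) :=
  A.pageCycles (r - 1) (p + 1) (q - 1) ⊔
    (A.pageCycles (r - 1) (p - r + 1) (q + r - 2)).map (A.totalD (p + q - 1))

/-- The term `E_r^{p,q}` of the characteristic spectral sequence (for `r ≥ 1`), the spectral sequence
of the Hochschild complex filtered by columns. -/
abbrev Page (r p q : ℤ) : Type w :=
  A.pageCycles r p q ⧸ (A.pageBoundaries r p q).submoduleOf (A.pageCycles r p q)

theorem hochschildCocycles_le_pageCycles (r t : ℤ) :
    A.hochschildCocycles t ≤ A.pageCycles r 0 t := by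
  rintro φ ⟨h, h'⟩
  have h' : A.totalD t φ = 0 := h'
  refine ⟨⟨by rwa [zero_add], fun s hs => absurd hs (by omega)⟩, ?_⟩
  change A.totalD (0 + t) φ ∈ A.columnFiltration (0 + r)
  rw [show (0 : ℤ) + t = t from zero_add t, h']
  exact Submodule.zero_mem _

theorem hochschildCoboundaries_le_pageBoundaries (t : ℤ) :
    A.hochschildCoboundaries t ≤ A.pageBoundaries 2 0 t := by
  refine le_trans ?_ le_sup_right
  rintro _ ⟨φ, hφ, rfl⟩
  refine ⟨φ, ⟨⟨?_, fun s hs => absurd hs (by omega)⟩, fun s hs => absurd hs (by omega)⟩, ?_⟩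
  · rwa [show (0 : ℤ) - 2 + 1 + (t + 2 - 2) = t - 1 by ring]
  · rw [zero_add]

/-- The edge homomorphism `HHᵗ(A) → E_2^{0,t}` of the characteristic spectral sequence: a Hochschild
cocycle is sent to the class that it represents on the page. -/
noncomputable def edge (t : ℤ) : A.HH t →ₗ[K] A.Page 2 0 t :=
  Submodule.mapQ _ _ (Submodule.inclusion (A.hochschildCocycles_le_pageCycles 2 t))
    (fun _ h => A.hochschildCoboundaries_le_pageBoundaries t h)

variable {A}

/-- The element of `A` that corresponds to a map from the `0`-fold tensor power `K` to `A`. -/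
def multiZero : A.Multi 0 →ₗ[K] A where
  toFun φ := φ Fin.elim0
  map_add' _ _ := rfl
  map_smul' _ _ := rfl

theorem multiZero_internalD (t : ℤ) (φ : A.Multi 0) :
    multiZero (internalD t φ) = A.d (multiZero φ) := by
  simp [multiZero, internalD_apply]

theorem pageCycles_two {t : ℤ} {φ : ∀ s : ℕ, A.Multi s} (h : φ ∈ A.pageCycles 2 0 t) :
    A.d (multiZero (φ 0)) = 0 ∧ hochschildD t (φ 0) = internalD (t - 1) (φ 1) := by
  have h0 := h.2 0 (by norm_num)
  have h1 := h.2 1 (by norm_num)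
  rw [zero_add] at h0 h1
  rw [totalD_zero_apply] at h0
  have h1 : (-1 : K) ^ (0 + 1) • internalD (t - (0 + 1 : ℕ)) (φ (0 + 1)) +
    hochschildD (t - (0 : ℕ)) (φ 0) = 0 := h1
  refine ⟨by rw [← multiZero_internalD, h0, map_zero], ?_⟩
  simpa [neg_add_eq_zero, eq_comm] using h1

/-- The class of the zeroth component of a cycle on the second page is in the graded center. -/
theorem class_mem_gradedCenter {t : ℤ} {φ : ∀ s : ℕ, A.Multi s} (h : φ ∈ A.pageCycles 2 0 t) :
    A.cohomologyClass ⟨multiZero (φ 0), (pageCycles_two h).1⟩ ∈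
      A.cohomologyDGA.gradedCenter t := by
  have hdeg : multiZero (φ 0) ∈ A.grading t := by
    have := h.1.1 0 Fin.elim0 Fin.elim0 (fun i => i.elim0)
    simpa [multiZero] using this
  refine ⟨⟨_, hdeg, rfl⟩, ?_⟩
  rintro n _ ⟨z, hz, rfl⟩
  have hz : (z : A) ∈ A.grading n := hz
  have hz' : A.d z = 0 := z.2
  have hd := DFunLike.congr_fun (pageCycles_two h).2 (fun _ => (z : A))
  have hs : φ 1 (fun j => A.slot 0 j ((fun _ => (z : A)) j)) = 0 :=
    (φ 1).map_coord_zero 0 (by simp [slot, hz'])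
  rw [hochschildD_apply, internalD_apply] at hd
  have e0 : ∀ f : Fin 0 → A, φ 0 f = multiZero (φ 0) := fun f =>
    congrArg _ (Subsingleton.elim _ _)
  simp only [Fin.sum_univ_zero, Fin.sum_univ_one, e0, hs, smul_zero, sub_zero, add_zero,
    zero_add, pow_one, neg_smul, one_smul, A.koszul_apply t hz] at hd
  change A.cohomologyClass z * A.cohomologyClass ⟨multiZero (φ 0), _⟩ =
    (-1 : K) ^ (n * t) • (A.cohomologyClass ⟨multiZero (φ 0), _⟩ * A.cohomologyClass z)
  rw [← map_mul, ← map_mul, ← map_smul, ← sub_eq_zero, ← map_sub]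
  refine Ideal.Quotient.eq_zero_iff_mem.2 ⟨(-1 : K) ^ (n * t) • φ 1 (fun _ => (z : A)), ?_⟩
  rw [map_smul, ← hd, mul_comm t n, smul_mul_assoc, smul_add, smul_smul, neg_one_zpow_mul_self,
    one_smul, smul_neg, ← sub_eq_add_neg]
  rfl

variable (A)

/-- The comparison of the zeroth column of the second page with the graded center of the
cohomology algebra: the class of `(φₛ)` is sent to the cohomology class of `φ₀ ∈ A`. -/
noncomputable def pageToCenter (t : ℤ) :
    A.Page 2 0 t →ₗ[K] A.cohomologyDGA.gradedCenter t :=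
  Submodule.liftQ _
    { toFun := fun φ => ⟨A.cohomologyClass ⟨multiZero (φ.1 0), (pageCycles_two φ.2).1⟩,
        class_mem_gradedCenter φ.2⟩
      map_add' := fun _ _ => rfl
      map_smul' := fun _ _ => rfl }
    (by
      rintro ⟨φ, hφ⟩ h
      obtain ⟨ψ, hψ, χ, ⟨ω, -, rfl⟩, hsum⟩ := Submodule.mem_sup.1 h
      refine Subtype.ext (Ideal.Quotient.eq_zero_iff_mem.2 ⟨multiZero (ω 0), ?_⟩)
      have hψ0 : ψ 0 = 0 := hψ.1.2 0 (by norm_num)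
      have hφ0 : φ 0 = ψ 0 + A.totalD (0 + t - 1) ω 0 := (congrFun hsum 0).symm
      rw [hψ0, zero_add, totalD_zero_apply] at hφ0
      change A.d (multiZero (ω 0)) = multiZero (φ 0)
      rw [hφ0, multiZero_internalD])

/-- The characteristic edge homomorphism `HHᵗ(A) → E_2^{0,t} = Zᵗ(H(A)) ⊆ Hᵗ(A)` (the last inclusion
being an equality if `H(A)` is graded commutative). -/
noncomputable def edgeHom (t : ℤ) : A.HH t →ₗ[K] A.HGroup t :=
  Submodule.inclusion (A.cohomologyDGA.gradedCenter_le t) ∘ₗ A.pageToCenter t ∘ₗ A.edge t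

/-- The value of the edge homomorphism on the class of a Hochschild cocycle. -/
theorem edgeHom_mk (t : ℤ) (φ : A.hochschildCocycles t) :
    (A.edgeHom t (Submodule.Quotient.mk φ)).val =
      A.cohomologyClass ⟨multiZero (φ.1 0),
        (pageCycles_two (A.hochschildCocycles_le_pageCycles 2 t φ.2)).1⟩ := rfl

end DGAlgebra

/-! ### Cochains on simplicial sets and spaces -/

namespace SimplicialCochains

/-- The simplices of all dimensions of a simplicial set: `⟨n, σ⟩` is an `n`-simplex `σ`. -/
abbrev Simplices (S : SSet.{v}) : Type v :=
  Σ n : ℕ, S.obj (Opposite.op (SimplexCategory.mk n))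

variable {S : SSet.{v}}

/-- The `m`-simplex of a given simplex with the vertices `g 0 ≤ g 1 ≤ ⋯ ≤ g m`.  Vertices beyond
the last one are replaced by the last one. -/
def pull (x : Simplices S) (m : ℕ) (g : ℕ → ℕ) (hg : Monotone g) : Simplices S :=
  ⟨m, S.map (SimplexCategory.mkHom (n := m) (m := x.1)
    ⟨fun j => ⟨min (g j) x.1, by omega⟩, fun _ _ h => min_le_min_right _ (hg h)⟩).op x.2⟩

theorem add_mono (a : ℕ) : Monotone (fun j : ℕ => a + j) :=
  fun _ _ h => Nat.add_le_add_left h a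

/-- The simplex of dimension `b - a` with the vertices `a, a + 1, …, b` of a given simplex, for
`a ≤ b` at most its dimension. -/
def seg (x : Simplices S) (a b : ℕ) : Simplices S :=
  pull x (b - a) (fun j => a + j) (add_mono a)

theorem skip_mono (i : ℕ) : Monotone (fun j : ℕ => if j < i then j else j + 1) := by
  intro a b h
  dsimp only
  split_ifs <;> omega

/-- The face that omits the vertex `i`. -/
def face (x : Simplices S) (i : ℕ) : Simplices S :=
  pull x (x.1 - 1) (fun j => if j < i then j else j + 1) (skip_mono i)

theorem simplexCategory_hom_ext {m n : ℕ} {f g : SimplexCategory.mk m ⟶ SimplexCategory.mk n}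
    (h : ∀ j : Fin (m + 1), (f.toOrderHom j : ℕ) = (g.toOrderHom j : ℕ)) : f = g :=
  SimplexCategory.Hom.ext _ _ (OrderHom.ext _ _ (funext fun j => Fin.ext (h j)))

theorem pull_congr (x : Simplices S) {m m' : ℕ} {g g' : ℕ → ℕ} (hg : Monotone g)
    (hg' : Monotone g') (hm : m = m') (h : ∀ j ≤ m, min (g j) x.1 = min (g' j) x.1) :
    pull x m g hg = pull x m' g' hg' := by
  subst hm
  unfold pull
  congr 3
  refine congrArg (fun f => S.map (Quiver.Hom.op f)) ?_
  exact simplexCategory_hom_ext fun j => h j (Nat.lt_succ_iff.1 j.2)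

theorem pull_pull (x : Simplices S) (m k : ℕ) {g h : ℕ → ℕ} (hg : Monotone g) (hh : Monotone h) :
    pull (pull x m g hg) k h hh = pull x k (fun j => g (min (h j) m))
      (fun _ _ hab => hg (min_le_min_right _ (hh hab))) := by
  unfold pull
  dsimp only
  rw [← CategoryTheory.comp_apply, ← S.map_comp, ← CategoryTheory.op_comp]
  rfl

theorem pull_self (x : Simplices S) {g : ℕ → ℕ} (hg : Monotone g) (h : ∀ j ≤ x.1, g j = j) :
    pull x x.1 g hg = x := by
  obtain ⟨n, σ⟩ := x
  unfold pull
  dsimp only at *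
  congr 1
  convert CategoryTheory.types_id_apply _ σ
  rw [← S.map_id, ← CategoryTheory.op_id]
  congr 2
  refine simplexCategory_hom_ext fun j => ?_
  have hj : (j : ℕ) ≤ n := Nat.lt_succ_iff.1 j.2
  have : min (g j) n = j := by rw [h j hj, min_eq_left hj]
  exact this

theorem face_eq (n : ℕ) (σ : S.obj (Opposite.op (SimplexCategory.mk (n + 1)))) (i : Fin (n + 2)) :
    (⟨n, CategoryTheory.SimplicialObject.δ S i σ⟩ : Simplices S) = face ⟨n + 1, σ⟩ i := by
  unfold face pull
  dsimp only
  congr 1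
  rw [CategoryTheory.SimplicialObject.δ]
  congr 1
  refine congrArg (fun f => CategoryTheory.ConcreteCategory.hom (S.map (Quiver.Hom.op f)))
    (simplexCategory_hom_ext fun j => ?_)
  have hj : (j : ℕ) ≤ n := Nat.lt_succ_iff.1 j.2
  change ((i.succAbove j : Fin (n + 2)) : ℕ) = min (if (j : ℕ) < i then (j : ℕ) else j + 1) (n + 1)
  unfold Fin.succAbove
  simp only [Fin.lt_def, Fin.val_castSucc]
  split_ifs
  · rw [Fin.val_castSucc]; omega
  · rw [Fin.val_succ]; omega


variable {K : Type u} [Field K]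

/-- The cup product of cochains,
`(f ∪ g)(σ) = ∑ₚ f(σ restricted to the vertices 0, …, p) g(σ restricted to the vertices p, …, n)`
for `σ` of dimension `n`. -/
def cup (f g : Simplices S → K) (x : Simplices S) : K :=
  ∑ p ∈ Finset.range (x.1 + 1), f (seg x 0 p) * g (seg x p x.1)

/-- The coboundary `(δf)(σ) = ∑ᵢ (-1)ⁱ f(dᵢ σ)`. -/
def coboundary (f : Simplices S → K) : Simplices S → K
  | ⟨0, _⟩ => 0
  | ⟨n + 1, σ⟩ => ∑ i : Fin (n + 2),
      (-1 : K) ^ (i : ℕ) * f ⟨n, CategoryTheory.SimplicialObject.δ S i σ⟩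

theorem coboundary_of_dim_zero (f : Simplices S → K) (x : Simplices S) (h : x.1 = 0) :
    coboundary f x = 0 := by
  obtain ⟨n, σ⟩ := x
  dsimp only at h
  subst h
  rfl

theorem coboundary_of_dim_succ (f : Simplices S → K) (x : Simplices S) {n : ℕ} (h : x.1 = n + 1) :
    coboundary f x = ∑ i ∈ Finset.range (n + 2), (-1 : K) ^ i * f (face x i) := by
  obtain ⟨m, σ⟩ := x
  dsimp only at h
  subst h
  rw [← Fin.sum_univ_eq_sum_range (fun i => (-1 : K) ^ i * f (face ⟨n + 1, σ⟩ i))]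
  simp only [coboundary, face_eq]

theorem seg_dim (x : Simplices S) (a b : ℕ) : (seg x a b).1 = b - a := rfl

theorem face_dim (x : Simplices S) (i : ℕ) : (face x i).1 = x.1 - 1 := rfl

theorem seg_seg (x : Simplices S) {a b c d : ℕ} (hab : a + d ≤ b) (hcd : c ≤ d) :
    seg (seg x a b) c d = seg x (a + c) (a + d) := by
  unfold seg
  rw [pull_pull]
  refine pull_congr _ _ _ (by omega) fun j hj => ?_
  rw [min_eq_left (by omega : c + j ≤ b - a), add_assoc]

theorem seg_self (x : Simplices S) {a b : ℕ} (ha : a = 0) (hb : b = x.1) : seg x a b = x := by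
  subst ha hb
  exact pull_self x _ (fun j _ => by omega)

theorem face_face (x : Simplices S) {i j : ℕ} (hx : 2 ≤ x.1) (hij : j < i) (hi : i ≤ x.1) :
    face (face x i) j = face (face x j) (i - 1) := by
  unfold face
  rw [pull_pull, pull_pull]
  refine pull_congr _ _ _ rfl fun k hk => ?_
  change k ≤ x.1 - 1 - 1 at hk
  split_ifs <;> omega

theorem seg_face_front (x : Simplices S) {i p : ℕ} (hi : i ≤ p) (hp : p + 1 ≤ x.1) :
    seg (face x i) 0 p = face (seg x 0 (p + 1)) i := by
  unfold face seg
  rw [pull_pull, pull_pull]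
  refine pull_congr _ _ _ (by change p - 0 = p + 1 - 0 - 1; omega) fun k hk => ?_
  split_ifs <;> omega

theorem seg_face_front' (x : Simplices S) {i p : ℕ} (hi : p < i) (hp : p + 1 ≤ x.1) :
    seg (face x i) 0 p = seg x 0 p := by
  unfold face seg
  rw [pull_pull]
  refine pull_congr _ _ _ rfl fun k hk => ?_
  split_ifs <;> omega

theorem seg_face_back (x : Simplices S) {i p n : ℕ} (hn : x.1 = n + 1) (hi : i ≤ p) (hp : p ≤ n) :
    seg (face x i) p n = seg x (p + 1) (n + 1) := by
  unfold face seg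
  rw [pull_pull]
  refine pull_congr _ _ _ (by omega) fun k hk => ?_
  split_ifs <;> omega

theorem seg_face_back' (x : Simplices S) {i p n : ℕ} (hn : x.1 = n + 1) (hp : p ≤ n) :
    seg (face x (p + 1 + i)) p n = face (seg x p (n + 1)) (i + 1) := by
  unfold face seg
  rw [pull_pull, pull_pull]
  refine pull_congr _ _ _ (by change n - p = n + 1 - p - 1; omega) fun k hk => ?_
  split_ifs <;> omega

theorem cup_assoc (f g h : Simplices S → K) : cup (cup f g) h = cup f (cup g h) := by
  funext x
  have h1 : cup (cup f g) h x = ∑ q ∈ Finset.range (x.1 + 1), ∑ p ∈ Finset.range (q + 1),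
      f (seg x 0 p) * g (seg x p q) * h (seg x q x.1) := by
    refine Finset.sum_congr rfl fun q hq => ?_
    rw [cup, Finset.sum_mul]
    refine Finset.sum_congr rfl fun p hp => ?_
    rw [Finset.mem_range] at hp hq
    rw [seg_dim, Nat.sub_zero, seg_seg x (by omega) (by omega), seg_seg x (by omega) (by omega)]
    simp only [zero_add]
  have h2 : cup f (cup g h) x = ∑ p ∈ Finset.range (x.1 + 1), ∑ q ∈ Finset.Ico p (x.1 + 1),
      f (seg x 0 p) * g (seg x p q) * h (seg x q x.1) := by
    refine Finset.sum_congr rfl fun p hp => ?_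
    rw [Finset.mem_range] at hp
    rw [cup, Finset.mul_sum, seg_dim, Finset.sum_Ico_eq_sum_range,
      show x.1 + 1 - p = x.1 - p + 1 by omega]
    refine Finset.sum_congr rfl fun q hq => ?_
    rw [Finset.mem_range] at hq
    rw [seg_seg x (by omega) (by omega), seg_seg x (by omega) (by omega), mul_assoc]
    simp only [add_zero, show p + (x.1 - p) = x.1 by omega]
  rw [h1, h2]
  refine Finset.sum_comm' fun q p => ?_
  simp only [Finset.mem_range, Finset.mem_Ico]
  omega

/-- The unit cochain. -/
def unit (x : Simplices S) : K := if x.1 = 0 then 1 else 0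

theorem unit_cup (f : Simplices S → K) : cup unit f = f := by
  funext x
  rw [cup, Finset.sum_range_succ', Finset.sum_eq_zero]
  · simp [unit, seg_dim, seg_self]
  · intro p _
    simp [unit, seg_dim]

theorem cup_unit (f : Simplices S → K) : cup f unit = f := by
  funext x
  rw [cup, Finset.sum_range_succ, Finset.sum_eq_zero]
  · simp [unit, seg_dim, seg_self]
  · intro p hp
    rw [Finset.mem_range] at hp
    simp [unit, seg_dim, show x.1 - p ≠ 0 by omega]

theorem coboundary_coboundary (f : Simplices S → K) : coboundary (coboundary f) = 0 := by
  funext x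
  rcases hx : x.1 with _ | _ | n
  · exact coboundary_of_dim_zero _ x hx
  · rw [coboundary_of_dim_succ _ x hx]
    refine Finset.sum_eq_zero fun i _ => ?_
    rw [coboundary_of_dim_zero _ _ (by rw [face_dim, hx]), mul_zero]
  · rw [coboundary_of_dim_succ _ x hx]
    have h : ∀ i ∈ Finset.range (n + 1 + 2), (-1 : K) ^ i * coboundary f (face x i) =
        ∑ j ∈ Finset.range (n + 1 + 1), ((-1 : K) ^ i * (-1 : K) ^ j) • f (face (face x i) j) := by
      intro i _
      rw [coboundary_of_dim_succ f (face x i) (n := n) (by rw [face_dim, hx]; rfl), Finset.mul_sum]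
      simp only [smul_eq_mul, mul_assoc]
    rw [Finset.sum_congr rfl h]
    exact DGAlgebra.alternating_sum_eq_zero (n + 1) (fun i j => f (face (face x i) j))
      fun i j hij hi => congrArg f (face_face x (by omega) hij (by omega))

/-- The Leibniz rule. -/
theorem coboundary_cup (f g : Simplices S → K) :
    coboundary (cup f g) =
      cup (coboundary f) g + cup (fun x => (-1 : K) ^ x.1 * f x) (coboundary g) := by
  funext x
  rw [Pi.add_apply]
  rcases hx : x.1 with _ | n
  · rw [coboundary_of_dim_zero _ x hx, cup, cup, hx]
    simp [coboundary_of_dim_zero _ (seg x 0 0) (seg_dim x 0 0)]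
  · have key : ∀ p ∈ Finset.range (n + 1),
        ∑ i ∈ Finset.range (n + 2), (-1 : K) ^ i * (f (seg (face x i) 0 p) * g (seg (face x i) p n)) =
        coboundary f (seg x 0 (p + 1)) * g (seg x (p + 1) (n + 1)) +
          (-1 : K) ^ p * f (seg x 0 p) * coboundary g (seg x p (n + 1)) := by
      intro p hp
      rw [Finset.mem_range] at hp
      rw [coboundary_of_dim_succ f (seg x 0 (p + 1)) (n := p) (seg_dim _ _ _),
        coboundary_of_dim_succ g (seg x p (n + 1)) (n := n - p) (by rw [seg_dim]; omega),
        Finset.sum_range_succ _ (p + 1), Finset.sum_range_succ' _ (n - p + 1),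
        Finset.range_eq_Ico, ← Finset.sum_Ico_consecutive _ (Nat.zero_le (p + 1))
          (by omega : p + 1 ≤ n + 2), Finset.sum_Ico_eq_sum_range _ (p + 1),
        show n + 2 - (p + 1) = n - p + 1 by omega, ← Finset.range_eq_Ico]
      have e1 : ∀ i ∈ Finset.range (p + 1),
          (-1 : K) ^ i * (f (seg (face x i) 0 p) * g (seg (face x i) p n)) =
          (-1 : K) ^ i * f (face (seg x 0 (p + 1)) i) * g (seg x (p + 1) (n + 1)) := by
        intro i hi
        rw [Finset.mem_range] at hi
        rw [seg_face_front x (by omega) (by omega), seg_face_back x hx (by omega) (by omega),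
          mul_assoc]
      have e2 : ∀ i ∈ Finset.range (n - p + 1),
          (-1 : K) ^ (p + 1 + i) *
            (f (seg (face x (p + 1 + i)) 0 p) * g (seg (face x (p + 1 + i)) p n)) =
          (-1 : K) ^ p * f (seg x 0 p) *
            ((-1 : K) ^ (i + 1) * g (face (seg x p (n + 1)) (i + 1))) := by
        intro i hi
        rw [seg_face_front' x (by omega) (by omega), seg_face_back' x hx (by omega)]
        ring
      have e3 : face (seg x 0 (p + 1)) (p + 1) = seg x 0 p := by
        unfold face seg
        rw [pull_pull]
        refine pull_congr _ _ _ rfl fun k hk => ?_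
        change k ≤ p + 1 - 0 - 1 at hk
        split_ifs <;> omega
      have e4 : face (seg x p (n + 1)) 0 = seg x (p + 1) (n + 1) := by
        unfold face seg
        rw [pull_pull]
        refine pull_congr _ _ _ (by change n + 1 - p - 1 = n + 1 - (p + 1); omega) fun k hk => ?_
        change k ≤ n + 1 - p - 1 at hk
        split_ifs <;> omega
      rw [Finset.sum_congr rfl e1, Finset.sum_congr rfl e2, ← Finset.sum_mul, ← Finset.mul_sum,
        e3, e4]
      ring
    rw [coboundary_of_dim_succ _ x hx]
    simp only [cup, face_dim, hx, Nat.add_sub_cancel, Finset.mul_sum, seg_dim, Nat.sub_zero]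
    rw [Finset.sum_comm, Finset.sum_congr rfl key, Finset.sum_add_distrib,
      Finset.sum_range_succ' (fun p => coboundary f (seg x 0 p) * g (seg x p (n + 1))),
      Finset.sum_range_succ (fun p => (-1 : K) ^ p * f (seg x 0 p) * coboundary g (seg x p (n + 1)))
        (n + 1),
      coboundary_of_dim_zero f (seg x 0 0) (seg_dim x 0 0),
      coboundary_of_dim_zero g (seg x (n + 1) (n + 1)) (by rw [seg_dim]; omega)]
    ring

end SimplicialCochains

namespace SimplicialCochains

variable {K : Type u} [Field K] {S : SSet.{v}}

variable (K S) in
/-- The underlying vector space `⨁ₙ Cⁿ(S; K)` of the cochain algebra: functions on the simplices of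
`S` that vanish on all simplices of sufficiently large dimension. -/
def cochains : Submodule K (Simplices S → K) where
  carrier := {f | ∃ N : ℕ, ∀ x : Simplices S, N < x.1 → f x = 0}
  zero_mem' := ⟨0, fun _ _ => rfl⟩
  add_mem' := by
    rintro f g ⟨M, hf⟩ ⟨N, hg⟩
    refine ⟨max M N, fun x hx => ?_⟩
    rw [Pi.add_apply, hf x (by omega), hg x (by omega), add_zero]
  smul_mem' := by
    rintro c f ⟨M, hf⟩
    exact ⟨M, fun x hx => by rw [Pi.smul_apply, hf x hx, smul_zero]⟩

theorem cup_mem {f g : Simplices S → K} (hf : f ∈ cochains K S) (hg : g ∈ cochains K S) :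
    cup f g ∈ cochains K S := by
  obtain ⟨M, hf⟩ := hf
  obtain ⟨N, hg⟩ := hg
  refine ⟨M + N, fun x hx => Finset.sum_eq_zero fun p _ => ?_⟩
  by_cases hp : M < p
  · rw [hf _ (by rw [seg_dim]; omega), zero_mul]
  · rw [hg _ (by rw [seg_dim]; omega), mul_zero]

theorem unit_mem : (unit : Simplices S → K) ∈ cochains K S :=
  ⟨0, fun x hx => if_neg (by omega)⟩

theorem coboundary_mem {f : Simplices S → K} (hf : f ∈ cochains K S) :
    coboundary f ∈ cochains K S := by
  obtain ⟨M, hf⟩ := hf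
  refine ⟨M + 1, fun x hx => ?_⟩
  obtain ⟨n, hn⟩ : ∃ n, x.1 = n + 1 := ⟨x.1 - 1, by omega⟩
  rw [coboundary_of_dim_succ f x hn]
  exact Finset.sum_eq_zero fun i _ => by rw [hf _ (by rw [face_dim]; omega), mul_zero]

theorem cup_add (f g h : Simplices S → K) : cup f (g + h) = cup f g + cup f h := by
  funext x; simp [cup, mul_add, Finset.sum_add_distrib]

theorem add_cup (f g h : Simplices S → K) : cup (f + g) h = cup f h + cup g h := by
  funext x; simp [cup, add_mul, Finset.sum_add_distrib]

theorem smul_cup (c : K) (f g : Simplices S → K) : cup (c • f) g = c • cup f g := by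
  funext x; simp [cup, Finset.mul_sum, mul_assoc]

theorem cup_smul (c : K) (f g : Simplices S → K) : cup f (c • g) = c • cup f g := by
  funext x; simp [cup, Finset.mul_sum, mul_left_comm]

/-- The cochain algebra, with the cup product as multiplication. -/
instance : Ring (cochains K S) :=
  { (inferInstance : AddCommGroup (cochains K S)) with
    mul := fun f g => ⟨cup f.1 g.1, cup_mem f.2 g.2⟩
    one := ⟨unit, unit_mem⟩
    mul_assoc := fun f g h => Subtype.ext (cup_assoc f.1 g.1 h.1)
    one_mul := fun f => Subtype.ext (unit_cup f.1)
    mul_one := fun f => Subtype.ext (cup_unit f.1)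
    left_distrib := fun f g h => Subtype.ext (cup_add f.1 g.1 h.1)
    right_distrib := fun f g h => Subtype.ext (add_cup f.1 g.1 h.1)
    zero_mul := fun f => Subtype.ext (by
      change cup 0 f.1 = 0
      simpa using smul_cup (0 : K) 0 f.1)
    mul_zero := fun f => Subtype.ext (by
      change cup f.1 0 = 0
      simpa using cup_smul (0 : K) f.1 0) }

instance : Algebra K (cochains K S) :=
  Algebra.ofModule (fun c f g => Subtype.ext (smul_cup c f.1 g.1))
    (fun c f g => Subtype.ext (cup_smul c f.1 g.1))

theorem coe_mul (f g : cochains K S) : (f * g).1 = cup f.1 g.1 := rfl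

theorem coe_one : (1 : cochains K S).1 = unit := rfl

variable (K S) in
/-- `Cⁿ(S; K)`: the cochains that vanish on all simplices of dimension different from `n`. -/
def grading (n : ℤ) : Submodule K (cochains K S) where
  carrier := {f | ∀ x : Simplices S, (x.1 : ℤ) ≠ n → f.1 x = 0}
  zero_mem' _ _ := rfl
  add_mem' {f g} hf hg x hx := by
    change f.1 x + g.1 x = 0
    rw [hf x hx, hg x hx, add_zero]
  smul_mem' c f hf x hx := by
    change c * f.1 x = 0
    rw [hf x hx, mul_zero]

/-- Restriction of a cochain to the simplices of dimension `n`. -/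
noncomputable def restrictDim (n : ℤ) : cochains K S →ₗ[K] cochains K S where
  toFun f := ⟨fun x => if (x.1 : ℤ) = n then f.1 x else 0, by
    obtain ⟨N, hN⟩ := f.2
    exact ⟨N, fun x hx => by
      dsimp only
      rw [hN x hx, ite_self]⟩⟩
  map_add' f g := Subtype.ext (funext fun x => by
    change (if _ then f.1 x + g.1 x else 0) = (if _ then f.1 x else 0) + (if _ then g.1 x else 0)
    split_ifs <;> simp)
  map_smul' c f := Subtype.ext (funext fun x => by
    change (if _ then c * f.1 x else 0) = c * (if _ then f.1 x else 0)
    split_ifs <;> simp)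

theorem grading_isInternal : DirectSum.IsInternal (grading K S) := by
  refine DGAlgebra.isInternal_of_proj _ restrictDim ?_ ?_ ?_
  · intro n f hf
    refine Subtype.ext (funext fun x => ?_)
    change (if (x.1 : ℤ) = n then f.1 x else 0) = f.1 x
    split_ifs with h
    · rfl
    · exact (hf x h).symm
  · intro m n hmn f hf
    refine Subtype.ext (funext fun x => ?_)
    change (if (x.1 : ℤ) = n then f.1 x else 0) = 0
    split_ifs with h
    · exact hf x (by omega)
    · rfl
  · rw [eq_top_iff]
    rintro f -
    obtain ⟨N, hN⟩ := f.2
    have hf : f = ∑ n ∈ Finset.range (N + 1), restrictDim (n : ℤ) f := by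
      refine Subtype.ext (funext fun x => ?_)
      rw [AddSubmonoidClass.coe_finsetSum, Finset.sum_apply]
      change f.1 x = ∑ n ∈ Finset.range (N + 1), if (x.1 : ℤ) = n then f.1 x else 0
      simp only [Nat.cast_inj, Finset.sum_ite_eq, Finset.mem_range]
      split_ifs with h
      · rfl
      · exact hN x (by omega)
    rw [hf]
    refine Submodule.sum_mem _ fun n _ => Submodule.mem_iSup_of_mem (n : ℤ) ?_
    intro x hx
    exact if_neg hx

noncomputable instance : GradedAlgebra (grading K S) where
  one_mem x hx := if_neg (by omega)
  mul_mem m n f g hf hg x hx := by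
    rw [coe_mul]
    refine Finset.sum_eq_zero fun p hp => ?_
    rw [Finset.mem_range] at hp
    by_cases hpm : (p : ℤ) = m
    · rw [hg _ (by rw [seg_dim]; omega), mul_zero]
    · rw [hf _ (by rw [seg_dim]; omega), zero_mul]
  toDecomposition := grading_isInternal.chooseDecomposition

/-- The coboundary as a linear map. -/
def coboundaryLinear : cochains K S →ₗ[K] cochains K S where
  toFun f := ⟨coboundary f.1, coboundary_mem f.2⟩
  map_add' f g := Subtype.ext (funext fun x => by
    change coboundary (f.1 + g.1) x = coboundary f.1 x + coboundary g.1 x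
    rcases h : x.1 with _ | n
    · simp [coboundary_of_dim_zero _ x h]
    · simp [coboundary_of_dim_succ _ x h, mul_add, Finset.sum_add_distrib])
  map_smul' c f := Subtype.ext (funext fun x => by
    change coboundary (c • f.1) x = c * coboundary f.1 x
    rcases h : x.1 with _ | n
    · simp [coboundary_of_dim_zero _ x h]
    · simp [coboundary_of_dim_succ _ x h, Finset.mul_sum, mul_left_comm])

variable (K S) in
/-- The differential graded algebra of cochains on a simplicial set with coefficients in `K`, with
the cup product. -/
noncomputable def cochainDGA : DGAlgebra.{u, max u v} K where
  carrier := cochains K S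
  grading := grading K S
  d := coboundaryLinear
  d_mem n f hf x hx := by
    change coboundary f.1 x = 0
    rcases h : x.1 with _ | k
    · exact coboundary_of_dim_zero _ x h
    · rw [coboundary_of_dim_succ _ x h]
      exact Finset.sum_eq_zero fun i _ => by
        rw [hf _ (by rw [face_dim]; omega), mul_zero]
  d_d f := Subtype.ext (coboundary_coboundary f.1)
  leibniz n f g hf := by
    refine Subtype.ext ((coboundary_cup f.1 g.1).trans ?_)
    rw [show (fun x => (-1 : K) ^ x.1 * f.1 x) = (-1 : K) ^ n • f.1 from funext fun x => ?_]
    · rw [smul_cup]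
      rfl
    · rw [Pi.smul_apply, smul_eq_mul]
      by_cases hx : (x.1 : ℤ) = n
      · rw [← hx, zpow_natCast]
      · rw [hf x hx, mul_zero, mul_zero]

end SimplicialCochains

/-- The differential graded algebra `C X` of singular cochains with coefficients in `K` on a
topological space `X`, with the cup product. -/
noncomputable def singularCochains (K : Type u) [Field K] (X : Type v) [TopologicalSpace X] :
    DGAlgebra.{u, max u v} K :=
  SimplicialCochains.cochainDGA K (TopCat.toSSet.obj (TopCat.of X))

/-- A topological space `X` is formal over `K` if there are quasi-isomorphisms
`C X ← A → H(X)` of differential graded algebras, where the cohomology algebra `H(X)` of `C X` has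
the zero differential. -/
def IsFormalSpace (K : Type u) [Field K] (X : Type v) [TopologicalSpace X] : Prop :=
  ∃ (A : DGAlgebra.{u, w} K) (f : A.Hom (singularCochains K X))
    (g : A.Hom (singularCochains K X).cohomologyDGA), f.IsQuasiIso ∧ g.IsQuasiIso

-- Write `C` for the cochain algebra of `X`, `B` for its cohomology algebra with zero differential,
-- and `f : A → C`, `g : A → B` for the given quasi-isomorphisms. For `B` in place of `C` the claim
-- is immediate: `B` is graded commutative, so an element `z` of degree `t` placed alone in column
-- `0` is already a Hochschild cocycle. Its vertical differential is `d z = 0`, and its horizontal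
-- differential is the graded commutator with `z`. The proof carries such a cocycle along the zigzag
-- and keeps control of its zeroth component.
--
-- Hochschild cochains are not functorial in the algebra, so the transport passes through the mixed
-- bicomplexes `Hom(A ⊗ ⋯ ⊗ A, B)` and `Hom(A ⊗ ⋯ ⊗ A, C)`, where `A` acts on the coefficients
-- through `g` or `f`. Two maps have to be inverted on cohomology: postcomposition with `g` and
-- precomposition with `f`. Over a field a quasi-isomorphism has a homotopy inverse as a map of
-- complexes (`Hom.IsQuasiIso.nonempty_homotopyInverse`), and tensor powers and `Hom` preserve
-- homotopy equivalences, so both maps are quasi-isomorphisms in every column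
-- (`coneAcyclic_postcomp`, `coneAcyclic_precomp`). The homotopy inverse need not be multiplicative,
-- since a single column sees only the vertical differential. Because the total complex is a
-- product, a cocycle can then be lifted one column after the other without end, and its zeroth
-- component is prescribed up to a vertical coboundary (`ColumnBicomplex.exists_lift`).
--
-- Given a cocycle `z` of `C`, choose a cocycle `a` of `A` with `f a` cohomologous to `z`. The
-- central element `g a` is a cocycle with coefficients in `B`; it lifts to a Hochschild cocycle `x`
-- of `A`, and `x₀` is cohomologous to `a` since `g` is injective on cohomology. The pushforward of
-- `x` along `f` lifts to a Hochschild cocycle `y` of `C`, and `y₀` is cohomologous to `f x₀`, hence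
-- to `z` (`edgeHom_surjective`).
--
-- The remaining input is the graded commutativity of the cohomology of `X`. It comes from
-- Steenrod's cup-`1` product, whose coboundary on two cocycles is their graded commutator up to
-- sign (`coboundary_cupOne`).

universe w'

namespace DGAlgebra

variable {K : Type u} [Field K]

/-- The identity homomorphism. -/
def Hom.id (A : DGAlgebra.{u, w} K) : A.Hom A where
  toAlgHom := AlgHom.id K A
  map_mem _ _ h := h
  map_d _ := rfl

theorem Hom.map_koszul {A : DGAlgebra.{u, v} K} {B : DGAlgebra.{u, w} K} (f : A.Hom B) (t : ℤ)
    (a : A) : f.toAlgHom (A.koszul t a) = B.koszul t (f.toAlgHom a) := by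
  induction a using A.induction with
  | h0 => simp
  | hadd a a' h h' => simp [h, h']
  | hh m a ha => rw [A.koszul_apply t ha, B.koszul_apply t (f.map_mem m a ha), map_smul]

end DGAlgebra

/-! ### The Hochschild bicomplex of a homomorphism

For a homomorphism `f : A → B` of differential graded algebras, `B` is a bimodule over `A`, and
the Hochschild bicomplex of `A` with coefficients in `B` has the terms `Hom(A ⊗ ⋯ ⊗ A, B)`. -/

namespace DGAlgebra.Rel

variable {K : Type u} [Field K] {A : DGAlgebra.{u, v} K} {B : DGAlgebra.{u, w} K} {s : ℕ}

variable (A B) in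
/-- Linear maps from the `s`-fold tensor power of `A` to `B`. -/
abbrev Multi (s : ℕ) : Type (max v w) := MultilinearMap K (fun _ : Fin s => A) B

instance (s : ℕ) : AddCommGroup (Multi A B s) :=
  { (inferInstance : AddCommMonoid (Multi A B s)),
    (inferInstance : AddCommGroup (Multi A B s)) with }

/-- The maps of degree `t`. -/
def homogeneous (s : ℕ) (t : ℤ) : Submodule K (Multi A B s) where
  carrier := {φ | ∀ (n : Fin s → ℤ) (a : Fin s → A), (∀ i, a i ∈ A.grading (n i)) →
    φ a ∈ B.grading (∑ i, n i + t)}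
  zero_mem' _ _ _ := Submodule.zero_mem _
  add_mem' hφ hψ m a ha := add_mem (hφ m a ha) (hψ m a ha)
  smul_mem' c _ hφ m a ha := Submodule.smul_mem _ c (hφ m a ha)

/-- Precomposition with the differential of the `s`-fold tensor power of `A`. -/
noncomputable def precompD (φ : Multi A B s) : Multi A B s :=
  ∑ i : Fin s, φ.compLinearMap (A.slot i)

theorem precompD_apply (φ : Multi A B s) (a : Fin s → A) :
    precompD φ a = ∑ i, φ (fun j => A.slot i j (a j)) := by
  simp [precompD]

/-- The internal differential on elements of degree `t`. -/
noncomputable def internalD (t : ℤ) : Multi A B s →ₗ[K] Multi A B s where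
  toFun φ := B.d.compMultilinearMap φ - (-1 : K) ^ t • precompD φ
  map_add' φ ψ := by
    ext a
    simp only [precompD_apply, add_apply, sub_apply,
      smul_apply, LinearMap.compMultilinearMap_apply, map_add,
      Finset.sum_add_distrib, smul_add]
    abel
  map_smul' c φ := by
    ext a
    simp only [precompD_apply, sub_apply, RingHom.id_apply,
      smul_apply, LinearMap.compMultilinearMap_apply, map_smul, ← Finset.smul_sum,
      smul_sub, smul_comm c]

theorem internalD_apply (t : ℤ) (φ : Multi A B s) (a : Fin s → A) :
    internalD t φ a = B.d (φ a) - (-1 : K) ^ t • ∑ i, φ (fun j => A.slot i j (a j)) := by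
  simp [internalD, precompD_apply]

/-! ### The horizontal differential and its square. -/

section hochschild

variable (f : A.Hom B)

/-- The first coface. -/
noncomputable def firstFace (t : ℤ) (φ : Multi A B s) : Multi A B (s + 1) :=
  LinearMap.uncurryLeft (M := fun _ : Fin (s + 1) => A)
    { toFun := fun a => (LinearMap.mulLeft K (B.koszul t (f.toAlgHom a))).compMultilinearMap φ
      map_add' := fun a b => by ext; simp [add_mul]
      map_smul' := fun c a => by ext; simp }

/-- The inner cofaces. -/
def midFace (i : Fin s) (φ : Multi A B s) : Multi A B (s + 1) :=
  MultilinearMap.mk' (fun a => φ (i.castSucc.contractNth (· * ·) a))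
    (fun a k x y => by
      simp only [contractNth_update]
      split_ifs <;> simp [mul_add, add_mul])
    (fun a k c x => by
      simp only [contractNth_update]
      split_ifs <;> simp)

/-- The last coface. -/
noncomputable def lastFace (φ : Multi A B s) : Multi A B (s + 1) :=
  MultilinearMap.uncurryRight (M := fun _ : Fin (s + 1) => A)
    (((LinearMap.mul K B).compl₂ f.toAlgHom.toLinearMap).compMultilinearMap φ)

theorem firstFace_apply (t : ℤ) (φ : Multi A B s) (a : Fin (s + 1) → A) :
    firstFace f t φ a = B.koszul t (f.toAlgHom (a 0)) * φ (fun i => a i.succ) := rfl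

theorem midFace_apply (i : Fin s) (φ : Multi A B s) (a : Fin (s + 1) → A) :
    midFace i φ a = φ (i.castSucc.contractNth (· * ·) a) := rfl

theorem lastFace_apply (φ : Multi A B s) (a : Fin (s + 1) → A) :
    lastFace f φ a = φ (fun i => a i.castSucc) * f.toAlgHom (a (Fin.last s)) := rfl

/-- All the cofaces, with a uniform numbering. -/
noncomputable def coface (t : ℤ) (i : ℕ) (φ : Multi A B s) : Multi A B (s + 1) :=
  if i = 0 then firstFace f t φ else if h : i - 1 < s then midFace ⟨i - 1, h⟩ φ else lastFace f φ

theorem coface_add (t : ℤ) (i : ℕ) (φ ψ : Multi A B s) :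
    coface f t i (φ + ψ) = coface f t i φ + coface f t i ψ := by
  ext a
  unfold coface
  split_ifs <;> simp [firstFace_apply, midFace_apply, lastFace_apply, mul_add, add_mul]

theorem coface_smul (t : ℤ) (i : ℕ) (c : K) (φ : Multi A B s) :
    coface f t i (c • φ) = c • coface f t i φ := by
  ext a
  unfold coface
  split_ifs <;> simp [firstFace_apply, midFace_apply, lastFace_apply]

/-- The Hochschild differential on elements of degree `t`: the alternating sum of the cofaces. -/
noncomputable def hochschildD (t : ℤ) : Multi A B s →ₗ[K] Multi A B (s + 1) where
  toFun φ := ∑ i ∈ Finset.range (s + 2), (-1 : K) ^ i • coface f t i φ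
  map_add' φ ψ := by simp only [coface_add, smul_add, Finset.sum_add_distrib]
  map_smul' c φ := by simp only [coface_smul, Finset.smul_sum, smul_comm c, RingHom.id_apply]

theorem hochschildD_eq (t : ℤ) (φ : Multi A B s) :
    hochschildD f t φ = ∑ i ∈ Finset.range (s + 2), (-1 : K) ^ i • coface f t i φ := rfl

/-- The uniform numbering of cofaces suits the proof that the square vanishes; this split form suits
the comparison with the internal differential, where each kind of coface behaves differently. -/
theorem hochschildD_eq_faces (t : ℤ) (φ : Multi A B s) :
    hochschildD f t φ = firstFace f t φ + ∑ i : Fin s, (-1 : K) ^ ((i : ℕ) + 1) • midFace i φ +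
      (-1 : K) ^ (s + 1) • lastFace f φ := by
  rw [hochschildD_eq, Finset.sum_range_succ, Finset.sum_range_succ', ← Fin.sum_univ_eq_sum_range
    (fun i => (-1 : K) ^ (i + 1) • coface f t (i + 1) φ)]
  simp [coface, add_comm]

theorem hochschildD_apply (t : ℤ) (φ : Multi A B s) (a : Fin (s + 1) → A) :
    hochschildD f t φ a = B.koszul t (f.toAlgHom (a 0)) * φ (fun i => a i.succ) +
      ∑ i : Fin s, (-1 : K) ^ ((i : ℕ) + 1) • φ (i.castSucc.contractNth (· * ·) a) +
      (-1 : K) ^ (s + 1) • (φ (fun i => a i.castSucc) * f.toAlgHom (a (Fin.last s))) := by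
  simp [hochschildD_eq_faces, firstFace_apply, midFace_apply, lastFace_apply]

theorem hochschildD_mem {t : ℤ} {φ : Multi A B s} (h : φ ∈ homogeneous s t) :
    hochschildD f t φ ∈ homogeneous (s + 1) t := by
  intro n a ha
  rw [hochschildD_apply]
  refine add_mem (add_mem ?_ (Submodule.sum_mem _ fun i _ => Submodule.smul_mem _ _ ?_))
    (Submodule.smul_mem _ _ ?_)
  · have := SetLike.mul_mem_graded (B.koszul_mem t (f.map_mem _ _ (ha 0)))
      (h _ _ fun i => ha i.succ)
    rwa [Fin.sum_univ_succ, add_assoc]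
  · rw [← sum_contractNth i]
    refine h _ _ fun j => ?_
    unfold Fin.contractNth
    split_ifs
    · exact ha _
    · exact SetLike.mul_mem_graded (ha _) (ha _)
    · exact ha _
  · have := SetLike.mul_mem_graded (h _ _ fun i => ha i.castSucc) (f.map_mem _ _ (ha (Fin.last s)))
    rwa [Fin.sum_univ_castSucc, add_right_comm]

theorem coface_hochschildD (t : ℤ) (i : ℕ) (φ : Multi A B s) (a : Fin (s + 2) → A) :
    coface f t i (hochschildD f t φ) a =
      ∑ j ∈ Finset.range (s + 2), (-1 : K) ^ j • coface f t i (coface f t j φ) a := by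
  rw [hochschildD_eq]
  unfold coface
  split_ifs
  · simp only [firstFace_apply, sum_apply, Finset.mul_sum,
      smul_apply, mul_smul_comm]
  · simp only [midFace_apply, sum_apply, smul_apply]
  · simp only [lastFace_apply, sum_apply, Finset.sum_mul,
      smul_apply, smul_mul_assoc]

/-- These are the cosimplicial identities. Inner cofaces use associativity in `A`; when two adjacent
outer arguments are multiplied before or after acting on `B`, multiplicativity of `f` and
associativity in `B` are needed. -/
theorem coface_coface (t : ℤ) (i j : ℕ) (hij : j < i) (hi : i ≤ s + 2) (φ : Multi A B s)
    (a : Fin (s + 2) → A) :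
    coface f t i (coface f t j φ) a = coface f t j (coface f t (i - 1) φ) a := by
  obtain ⟨i, rfl⟩ : ∃ k, i = k + 1 := ⟨i - 1, by omega⟩
  rcases j with _ | j
  · rcases i with _ | i
    · simp only [coface, if_true, zero_add, Nat.sub_self, one_ne_zero, if_false,
        Nat.zero_lt_succ, dif_pos, midFace_apply, firstFace_apply]
      rw [← mul_assoc, ← koszul_mul, ← map_mul]
      rfl
    · by_cases hs : i < s
      · simp only [coface, if_true, Nat.add_sub_cancel, Nat.succ_ne_zero, if_false, hs,
          Nat.add_lt_add_iff_right, dif_pos, midFace_apply, firstFace_apply]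
        congr 2
        funext k
        simp only [Fin.contractNth, Fin.val_succ, Fin.val_castSucc, Nat.add_lt_add_iff_right,
          Nat.add_right_cancel_iff]
        rfl
      · simp only [coface, if_true, Nat.add_sub_cancel, Nat.succ_ne_zero, if_false, hs,
          Nat.add_lt_add_iff_right, dif_neg, not_false_eq_true, lastFace_apply, firstFace_apply,
          ← mul_assoc]
        rfl
  · by_cases hi' : i < s + 1
    · have hj : j < s := by omega
      obtain ⟨i, rfl⟩ : ∃ k, i = k + 1 := ⟨i - 1, by omega⟩
      have hi'' : i < s := by omega
      simp only [coface, Nat.add_sub_cancel, Nat.succ_ne_zero, if_false, hj, hi', hi'',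
        show j < s + 1 by omega, dif_pos, midFace_apply]
      congr 1
      funext k
      simp only [Fin.contractNth, Fin.val_succ, Fin.val_castSucc]
      split_ifs <;> first | rfl | omega | exact (mul_assoc _ _ _).symm
    · by_cases hj : j < s
      · simp only [coface, Nat.add_sub_cancel, Nat.succ_ne_zero, if_false, hj, hi',
          show j < s + 1 by omega, show ¬ i - 1 < s by omega, show i ≠ 0 by omega, dif_pos,
          dif_neg, not_false_eq_true, midFace_apply, lastFace_apply]
        congr 2
        simp only [Fin.contractNth, Fin.val_last, Fin.val_castSucc, show ¬ s < j by omega,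
          show s ≠ j by omega, if_false]
        rfl
      · have hj' : j = s := by omega
        subst hj'
        simp only [coface, Nat.add_sub_cancel, Nat.succ_ne_zero, if_false, hi',
          show j < j + 1 by omega, show ¬ i - 1 < j by omega, show i ≠ 0 by omega, dif_pos,
          lt_irrefl, dif_neg, not_false_eq_true, midFace_apply, lastFace_apply]
        rw [mul_assoc, ← map_mul]
        congr 1
        · congr 1
          funext k
          simp [Fin.contractNth]
        · simp [Fin.contractNth]

theorem hochschildD_hochschildD (t : ℤ) (φ : Multi A B s) :
    hochschildD f t (hochschildD f t φ) = 0 := by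
  ext a
  rw [hochschildD_eq f t (hochschildD f t φ)]
  simp only [sum_apply, smul_apply, coface_hochschildD,
    Finset.smul_sum, smul_smul, zero_apply]
  exact alternating_sum_eq_zero (s + 1) (fun i j => coface f t i (coface f t j φ) a)
    fun i j hij hi => coface_coface f t i j hij hi φ a

end hochschild

/-- Multiplying two neighbouring tensor factors is a chain map: this is the Leibniz rule, with the
Koszul sign of the left factor supplied by `slot`. -/
theorem slot_contractNth (i : Fin s) (φ : Multi A B s) (a : Fin (s + 1) → A) :
    ∑ l : Fin (s + 1), φ (i.castSucc.contractNth (· * ·) (fun k => A.slot l k (a k))) =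
      ∑ l : Fin s, φ (fun k => A.slot l k (i.castSucc.contractNth (· * ·) a k)) := by
  -- Of the `s + 1` positions of `d` on the left, the one at `i.castSucc` is split off. The others
  -- match the positions on the right one by one, except that `i.succ` and the split-off term
  -- together give `d` of the product.
  rw [Fin.sum_univ_succAbove _ i.castSucc, ← eq_sub_iff_add_eq, ← Finset.sum_sub_distrib,
    Finset.sum_eq_single i]
  · rw [eq_sub_iff_add_eq, Fin.succAbove_castSucc_self]
    have h : ∀ (l : Fin (s + 1)) (x : A), (l = i.castSucc ∨ l = i.succ) →
        x = A.slot l i.castSucc (a i.castSucc) * A.slot l i.succ (a i.succ) →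
        i.castSucc.contractNth (· * ·) (fun k => A.slot l k (a k)) =
          Function.update (fun k => A.slot i k (i.castSucc.contractNth (· * ·) a k)) i x := by
      rintro l x hl rfl
      have hl' : (l : ℕ) = i ∨ (l : ℕ) = i + 1 := hl.imp (fun h => by simp [h]) (fun h => by simp [h])
      funext k
      by_cases hk : k = i
      · subst hk; simp [Fin.contractNth]
      · rw [Function.update_of_ne hk]
        have hk' : (k : ℕ) ≠ i := fun h => hk (Fin.ext h)
        simp only [Fin.contractNth, Fin.val_castSucc, hk', if_false, slot, Fin.lt_def, Fin.ext_iff,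
          Fin.val_succ]
        split_ifs <;> first | rfl | (exfalso; omega)
    rw [h _ _ (Or.inl rfl) rfl, h _ _ (Or.inr rfl) rfl, ← φ.map_update_add]
    congr 1
    conv_rhs => rw [← Function.update_eq_self i
      (fun k => A.slot i k (i.castSucc.contractNth (· * ·) a k))]
    congr 1
    simp [slot, Fin.contractNth, d_mul, Fin.lt_def, Fin.ext_iff]
  · intro l _ hl
    have hl' : (l : ℕ) ≠ i := fun h => hl (Fin.ext h)
    rw [sub_eq_zero]
    congr 1
    funext k
    have hk : k = i ↔ (k : ℕ) = i := Fin.ext_iff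
    rcases lt_or_gt_of_ne hl' with h | h
    · rw [Fin.succAbove_of_castSucc_lt _ _ (show (l : ℕ) < i from h)]
      simp only [Fin.contractNth, Fin.val_castSucc, slot, Fin.lt_def, Fin.ext_iff, Fin.val_succ]
      split_ifs <;> first | rfl | (exfalso; omega)
    · rw [Fin.succAbove_of_le_castSucc _ _ (show (i : ℕ) ≤ l from h.le)]
      simp only [Fin.contractNth, Fin.val_castSucc, slot, Fin.lt_def, Fin.ext_iff, Fin.val_succ]
      split_ifs <;> first | rfl | (exfalso; omega) | exact koszul_mul _ _ _ _
  · simp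

theorem multi_ext {f g : Multi A B s} (h : ∀ (n : Fin s → ℤ) (a : Fin s → A),
    (∀ i, a i ∈ A.grading (n i)) → f a = g a) : f = g := by
  -- `S` is the set of slots whose argument may be inhomogeneous; multilinearity removes the slots
  -- of `S` one at a time.
  have key : ∀ (S : Finset (Fin s)) (a : Fin s → A),
      (∀ i ∉ S, ∃ n, a i ∈ A.grading n) → f a = g a := by
    intro S
    induction S using Finset.induction_on with
    | empty =>
      intro a ha
      choose n hn using fun i => ha i (Finset.notMem_empty i)
      exact h n a hn
    | insert i S _ ih =>
      intro a ha
      rw [← Function.update_eq_self i a]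
      generalize a i = x
      induction x using A.induction with
      | h0 => rw [f.map_update_zero, g.map_update_zero]
      | hadd x y hx hy => rw [f.map_update_add, g.map_update_add, hx, hy]
      | hh n x hx =>
        refine ih _ fun j hj => ?_
        by_cases hji : j = i
        · subst hji; exact ⟨n, by simpa using hx⟩
        · rw [Function.update_of_ne hji]
          exact ha j (by simp [hji, hj])
  ext a
  exact key Finset.univ a (by simp)

/-- Homogeneous multilinear maps are compatible with the parity automorphism up to sign. -/
theorem koszul_apply_homogeneous {t : ℤ} {φ : Multi A B s} (h : φ ∈ homogeneous s t)
    (a : Fin s → A) : B.koszul 1 (φ a) = (-1 : K) ^ t • φ (fun i => A.koszul 1 (a i)) := by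
  have key : (B.koszul 1).compMultilinearMap φ =
      (-1 : K) ^ t • φ.compLinearMap (fun _ => A.koszul 1) := by
    refine multi_ext fun n a ha => ?_
    have hprod : ∀ S : Finset (Fin s), ∏ i ∈ S, (-1 : K) ^ n i = (-1 : K) ^ ∑ i ∈ S, n i := by
      intro S
      induction S using Finset.induction_on with
      | empty => simp
      | insert i S hi ih => rw [Finset.prod_insert hi, Finset.sum_insert hi, ih,
          zpow_add₀ (by simp)]
    simp only [LinearMap.compMultilinearMap_apply, smul_apply,
      MultilinearMap.compLinearMap_apply]
    rw [B.koszul_apply 1 (h n a ha)]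
    simp only [A.koszul_apply 1 (ha _), one_mul]
    rw [φ.map_smul_univ, hprod, smul_smul, ← zpow_add₀ (by simp), add_comm]
  exact DFunLike.congr_fun key a

/-! ### The two differentials commute. -/

section commute

variable (f : A.Hom B)

/-- The internal differential raises the degree of `φ`, so the sign for moving past `a 0` changes
from `t` to `t + 1`. The extra `(-1) ^ |a 0|` is the sign that `d` acquires in passing `a 0`, and
the two terms with `d (a 0)` cancel. -/
theorem firstFace_internalD (t : ℤ) (φ : Multi A B s) :
    firstFace f (t + 1) (internalD t φ) = internalD t (firstFace f t φ) := by
  ext a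
  have h0 : B.koszul t (B.koszul 1 (f.toAlgHom (a 0))) = B.koszul (t + 1) (f.toAlgHom (a 0)) :=
    B.koszul_koszul t 1 _
  have h1 : B.koszul 1 (B.koszul t (f.toAlgHom (a 0))) = B.koszul (t + 1) (f.toAlgHom (a 0)) := by
    rw [koszul_koszul, add_comm]
  have h2 : ∀ i : Fin s, (fun j : Fin s => A.slot i.succ j.succ (a j.succ)) =
      fun j => A.slot i j (a j.succ) := by
    intro i; funext j; simp [slot]
  have h3 : (fun j : Fin s => A.slot 0 j.succ (a j.succ)) = fun j => a j.succ := by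
    funext j; simp [slot, Fin.ext_iff]
  have h4 : A.slot (0 : Fin (s + 1)) 0 = A.d := by simp [slot]
  have h5 : ∀ i : Fin s, A.slot i.succ 0 = A.koszul 1 := by intro i; simp [slot]
  simp only [firstFace_apply, internalD_apply, Fin.sum_univ_succ, h2, h3, h4, h5, f.map_koszul,
    f.map_d, h0, d_mul, h1,
    d_koszul, ← Finset.mul_sum, smul_add, smul_mul_assoc, mul_sub, mul_smul_comm]
  abel

theorem midFace_internalD (t : ℤ) (i : Fin s) (φ : Multi A B s) :
    midFace i (internalD t φ) = internalD t (midFace i φ) := by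
  ext a
  simp only [midFace_apply, internalD_apply, slot_contractNth]

/-- Homogeneity enters here: the Leibniz rule puts the parity automorphism on the value of `φ`,
while `slot` puts it on the arguments, and these agree only up to `(-1) ^ t`. -/
theorem lastFace_internalD {t : ℤ} {φ : Multi A B s} (h : φ ∈ homogeneous s t) :
    lastFace f (internalD t φ) = internalD t (lastFace f φ) := by
  ext a
  have h2 : ∀ i : Fin s, (fun j : Fin s => A.slot i.castSucc j.castSucc (a j.castSucc)) =
      fun j => A.slot i j (a j.castSucc) := by
    intro i; funext j; simp [slot]
  have h3 : (fun j : Fin s => A.slot (Fin.last s) j.castSucc (a j.castSucc)) =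
      fun j => A.koszul 1 (a j.castSucc) := by
    funext j; simp [slot, Fin.castSucc_lt_last]
  have h4 : A.slot (Fin.last s) (Fin.last s) = A.d := by simp [slot]
  have h5 : ∀ i : Fin s, A.slot i.castSucc (Fin.last s) = LinearMap.id := by
    intro i
    simp [slot, Fin.ext_iff, Fin.lt_def, i.2.ne', i.2.le]
  simp only [lastFace_apply, internalD_apply, Fin.sum_univ_castSucc, h2, h3, h4, h5, d_mul,
    koszul_apply_homogeneous h, ← Finset.sum_mul, smul_add, smul_mul_assoc, sub_mul,
    LinearMap.id_apply, f.map_d]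
  abel

theorem hochschildD_internalD {t : ℤ} {φ : Multi A B s} (h : φ ∈ homogeneous s t) :
    hochschildD f (t + 1) (internalD t φ) = internalD t (hochschildD f t φ) := by
  simp only [hochschildD_eq_faces, map_add, map_sum, map_smul, firstFace_internalD,
    midFace_internalD, lastFace_internalD f h]

end commute

theorem hochschildD_id (t : ℤ) (φ : A.Multi s) :
    DGAlgebra.hochschildD t φ = hochschildD (Hom.id A) t φ := by
  ext a
  rw [DGAlgebra.hochschildD_apply, hochschildD_apply]
  rfl

end DGAlgebra.Rel

/-! ### Lifting cocycles of product total complexes -/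

/-- A bicomplex over `K`, whose column `s` has the total space `X s`.  The vertical differential
`dv s t` and the horizontal differential `dh s t` are those on elements of degree `t`, and they
commute. -/
structure ColumnBicomplex (K : Type u) [Field K] where
  X : ℕ → Type w
  [addCommGroup : ∀ s, AddCommGroup (X s)]
  [module : ∀ s, Module K (X s)]
  homog : ∀ s, ℤ → Submodule K (X s)
  dv : ∀ s, ℤ → X s →ₗ[K] X s
  dh : ∀ s, ℤ → X s →ₗ[K] X (s + 1)
  dh_mem : ∀ {s t x}, x ∈ homog s t → dh s t x ∈ homog (s + 1) t
  dh_dh : ∀ s t x, dh (s + 1) t (dh s t x) = 0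
  dh_dv : ∀ {s t x}, x ∈ homog s t → dh s (t + 1) (dv s t x) = dv (s + 1) t (dh s t x)

namespace ColumnBicomplex

attribute [instance] ColumnBicomplex.addCommGroup ColumnBicomplex.module

variable {K : Type u} [Field K]

/-- Cocycles of degree `n` of the product total complex. -/
def IsCocycle (D : ColumnBicomplex.{u, w} K) (n : ℤ) (x : ∀ s, D.X s) : Prop :=
  (∀ s : ℕ, x s ∈ D.homog s (n - s)) ∧ D.dv 0 n (x 0) = 0 ∧
    ∀ s : ℕ, (-1 : K) ^ (s + 1) • D.dv (s + 1) (n - (s + 1 : ℕ)) (x (s + 1)) +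
      D.dh s (n - s) (x s) = 0

variable {D : ColumnBicomplex.{u, v} K} {E : ColumnBicomplex.{u, w} K}

/-- The cone of a map of columns is acyclic. -/
def ConeAcyclic (s : ℕ) (F : D.X s →ₗ[K] E.X s) : Prop :=
  ∀ (t : ℤ) (a : D.X s) (b : E.X s), a ∈ D.homog s (t + 1) → b ∈ E.homog s t →
    D.dv s (t + 1) a = 0 → F a = E.dv s t b →
      ∃ x ∈ D.homog s t, ∃ w ∈ E.homog s (t - 1), D.dv s t x = a ∧ F x - b = E.dv s (t - 1) w

theorem neg_one_pow_smul_smul {V : Type w} [AddCommGroup V] [Module K V] (s : ℕ) (x : V) :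
    (-1 : K) ^ s • (-1 : K) ^ s • x = x := by
  rw [smul_smul, ← mul_pow]
  simp

/-- The pair `p` is admissible as the column `s`, in which cochains have degree `r`, of a partial lift
of `y` through `F` together with a homotopy: the lift can be continued. -/
structure Continuable (F : ∀ s, D.X s →ₗ[K] E.X s) (y : ∀ s, E.X s) (s : ℕ) (r : ℤ)
    (p : D.X s × E.X s) : Prop where
  fst_mem : p.1 ∈ D.homog s r
  snd_mem : p.2 ∈ E.homog s (r - 1)
  dv_dh : D.dv (s + 1) r (D.dh s r p.1) = 0
  dh_sub : E.dh s r (F s p.1 - y s) = (-1 : K) ^ s • E.dh s r (E.dv s (r - 1) p.2)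

/-- The earlier homotopy `w` enters the next column only through `dh w`, which `dh` kills. So an
equation for `F x - y` after applying `dh` is all that the induction has to remember. -/
theorem Continuable.exists_next {F : ∀ s, D.X s →ₗ[K] E.X s} {y : ∀ s, E.X s}
    (hdh : ∀ s t x, F (s + 1) (D.dh s t x) = E.dh s t (F s x)) {s : ℕ}
    (hF : ConeAcyclic (s + 1) (F (s + 1))) {t : ℤ} (hys : y (s + 1) ∈ E.homog (s + 1) t)
    (hy1 : (-1 : K) ^ (s + 1) • E.dv (s + 1) t (y (s + 1)) + E.dh s (t + 1) (y s) = 0)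
    {p : D.X s × E.X s} (hp : Continuable F y s (t + 1) p) :
    ∃ q, Continuable F y (s + 1) t q ∧
      (-1 : K) ^ (s + 1) • D.dv (s + 1) t q.1 + D.dh s (t + 1) p.1 = 0 := by
  obtain ⟨x, w⟩ := p
  obtain ⟨hx, hw, h1, h2⟩ := hp
  dsimp only at hx hw h1 h2
  rw [add_sub_cancel_right] at hw h2
  have e1 : E.dv (s + 1) t (y (s + 1)) = (-1 : K) ^ s • E.dh s (t + 1) (y s) := by
    rw [← neg_one_pow_smul_smul (K := K) s (E.dv (s + 1) t (y (s + 1)))]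
    rw [pow_succ, mul_neg_one, neg_smul, neg_add_eq_zero] at hy1
    rw [hy1]
  -- The cocycle equation forces `dv x' = (-1) ^ s • dh x`. The target `y (s + 1)` is corrected by
  -- `dh w` so that its vertical differential is the image of this element.
  obtain ⟨x', hx', w', hw', h3, h4⟩ := hF t ((-1 : K) ^ s • D.dh s (t + 1) x)
    (y (s + 1) + E.dh s t w) (Submodule.smul_mem _ _ (D.dh_mem hx))
    (add_mem hys (E.dh_mem hw)) (by rw [map_smul, h1, smul_zero]) (by
      rw [map_sub, sub_eq_iff_eq_add] at h2
      rw [map_smul, hdh, h2, map_add, e1, smul_add, neg_one_pow_smul_smul, E.dh_dv hw]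
      exact add_comm _ _)
  -- The sign is the one that `dh_sub` carries in column `s + 1`.
  refine ⟨(x', (-1 : K) ^ (s + 1) • w'), ⟨hx', Submodule.smul_mem _ _ hw', ?_, ?_⟩, ?_⟩
  · dsimp only
    rw [← D.dh_dv hx', h3, map_smul, D.dh_dh, smul_zero]
  · dsimp only
    rw [map_smul, map_smul, neg_one_pow_smul_smul, ← h4, ← sub_sub, map_sub _ (_ - _),
      E.dh_dh, sub_zero]
  · dsimp only
    rw [h3, pow_succ, mul_neg_one, neg_smul, neg_one_pow_smul_smul, neg_add_cancel]

/-- A map of bicomplexes that is a quasi-isomorphism on each column is surjective on the cohomology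
of the product total complexes; here only the columns of index `0` are compared. -/
theorem exists_lift (F : ∀ s, D.X s →ₗ[K] E.X s)
    (hdh : ∀ s t x, F (s + 1) (D.dh s t x) = E.dh s t (F s x))
    (hF : ∀ s, ConeAcyclic s (F s)) {n : ℤ} {y : ∀ s, E.X s} (hy : E.IsCocycle n y) :
    ∃ x : ∀ s, D.X s, D.IsCocycle n x ∧
      ∃ w ∈ E.homog 0 (n - 1), F 0 (x 0) - y 0 = E.dv 0 (n - 1) w := by
  obtain ⟨hy, hy0, hy1⟩ := hy
  have step : ∀ (s : ℕ) (p : {p // Continuable F y s (n - s) p}),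
      ∃ q : {q // Continuable F y (s + 1) (n - (s + 1 : ℕ)) q},
      (-1 : K) ^ (s + 1) • D.dv (s + 1) (n - (s + 1 : ℕ)) q.1.1 + D.dh s (n - s) p.1.1 = 0 := by
    rintro s ⟨p, hp⟩
    have hy1 := hy1 s
    dsimp only
    -- Passing to the next column lowers the internal degree by one; `exists_next` wants the old
    -- degree written as the new one plus one.
    rw [show n - (s : ℤ) = n - (s + 1 : ℕ) + 1 by push_cast; ring] at hp hy1 ⊢
    obtain ⟨q, hq, hpq⟩ := hp.exists_next hdh (hF (s + 1)) (hy (s + 1)) hy1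
    exact ⟨⟨q, hq⟩, hpq⟩
  have hyz := hy 0
  rw [Nat.cast_zero, sub_zero] at hyz
  -- Column `0` has no predecessor, so the prescribed vertical differential is `0`.
  obtain ⟨x, hx, w, hw, h1, h2⟩ := hF 0 n 0 (y 0) (Submodule.zero_mem _) hyz
      (map_zero _) (by rw [hy0, map_zero])
  have hp0 : Continuable F y 0 (n - (0 : ℕ)) (x, w) := by
    rw [Nat.cast_zero, sub_zero]
    exact ⟨hx, hw, by rw [← D.dh_dv hx, h1, map_zero], by rw [h2, pow_zero, one_smul]⟩
  choose next hnext using step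
  -- The choices form an infinite family, which is a cochain because the total complex is a product.
  -- The homotopies need not fit together, as only column `0` is compared.
  let q : ∀ s : ℕ, {p // Continuable F y s (n - s) p} :=
    fun s => Nat.rec ⟨(x, w), hp0⟩ (fun s p => next s p) s
  exact ⟨fun s => (q s).1.1, ⟨fun s => (q s).2.1, h1, fun s => hnext s (q s)⟩, w, hw, h2⟩

/-- The cone of a homotopy equivalence is acyclic. -/
theorem coneAcyclic_of_homotopy {s : ℕ} (F : D.X s →ₗ[K] E.X s) (G : E.X s →ₗ[K] D.X s)
    (L : ℤ → D.X s →ₗ[K] D.X s) (M : ℤ → E.X s →ₗ[K] E.X s)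
    (hF : ∀ t x, F (D.dv s t x) = E.dv s t (F x)) (hG : ∀ t x, G (E.dv s t x) = D.dv s t (G x))
    (hFmem : ∀ t, ∀ x ∈ D.homog s t, F x ∈ E.homog s t)
    (hGmem : ∀ t, ∀ x ∈ E.homog s t, G x ∈ D.homog s t)
    (hLmem : ∀ t, ∀ x ∈ D.homog s (t + 1), L (t + 1) x ∈ D.homog s t)
    (hMmem : ∀ t, ∀ x ∈ E.homog s (t + 1), M (t + 1) x ∈ E.homog s t)
    (hL : ∀ t, ∀ x ∈ D.homog s (t + 1),
      D.dv s t (L (t + 1) x) + L (t + 1 + 1) (D.dv s (t + 1) x) = G (F x) - x)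
    (hM : ∀ t, ∀ x ∈ E.homog s (t + 1),
      E.dv s t (M (t + 1) x) + M (t + 1 + 1) (E.dv s (t + 1) x) = F (G x) - x) :
    ConeAcyclic s F := by
  intro t a b ha hb hda hab
  obtain ⟨r, rfl⟩ : ∃ r, t = r + 1 := ⟨t - 1, by ring⟩
  -- The first attempt `G b - L a` has the right differential, but `F` of it differs from `b` by `dv
  -- (M b) + c`, where `c` measures the failure of `F` to intertwine the two homotopies. Since `c`
  -- is a cocycle, `F (G c) - c = dv (M c)`, and subtracting `G c` repairs the defect.
  set c := M (r + 1 + 1) (F a) - F (L (r + 1 + 1) a) with hc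
  have hcmem : c ∈ E.homog s (r + 1) :=
    sub_mem (hMmem _ _ (hFmem _ _ ha)) (hFmem _ _ (hLmem _ _ ha))
  have ea : D.dv s (r + 1) (L (r + 1 + 1) a) = G (F a) - a := by
    have := hL (r + 1) a ha
    rwa [hda, map_zero, add_zero] at this
  have eb := hM (r + 1) (F a) (hFmem _ _ ha)
  rw [← hF, hda, map_zero, map_zero, add_zero] at eb
  have ec : E.dv s (r + 1) c = 0 := by
    rw [hc, map_sub, eb, ← hF, ea, map_sub, sub_self]
  have e1 := hM r b hb
  have e2 := hM r c hcmem
  rw [ec, map_zero, add_zero] at e2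
  refine ⟨G b - L (r + 1 + 1) a - G c,
    sub_mem (sub_mem (hGmem _ _ hb) (hLmem _ _ ha)) (hGmem _ _ hcmem), M (r + 1) (b - c), ?_, ?_, ?_⟩
  · rw [add_sub_cancel_right]
    exact hMmem _ _ (sub_mem hb hcmem)
  · rw [map_sub, map_sub, ea, ← hG, ← hG, ec, map_zero, ← hab]
    abel
  · rw [← hab] at e1
    rw [add_sub_cancel_right, map_sub, map_sub, map_sub (M _), map_sub (E.dv s r), e2,
      eq_sub_of_add_eq e1, hc]
    abel

end ColumnBicomplex

/-! ### Homotopy inverses of quasi-isomorphisms -/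

namespace DGAlgebra

variable {K : Type u} [Field K]

/-- An acyclic differential vector space is contractible. -/
theorem exists_contraction {V : Type w} [AddCommGroup V] [Module K V] (D : V →ₗ[K] V)
    (hDD : ∀ x, D (D x) = 0) (hD : ∀ x, D x = 0 → ∃ y, D y = x) :
    ∃ k : V →ₗ[K] V, ∀ x, D (k x) + k (D x) = x := by
  -- `r` is a linear section of `D` over its range and `σ` extends it to `V`, so that `D σ D = D`.
  obtain ⟨r, hr⟩ := D.rangeRestrict.exists_rightInverse_of_surjective D.range_rangeRestrict
  obtain ⟨σ, hσ⟩ := r.exists_extend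
  have hσ' : ∀ x, D (σ (D x)) = D x := by
    intro x
    have h1 : σ (D x) = r ⟨D x, x, rfl⟩ := DFunLike.congr_fun hσ ⟨D x, x, rfl⟩
    have h2 := congrArg Subtype.val (DFunLike.congr_fun hr ⟨D x, x, rfl⟩)
    rw [h1]
    exact h2
  -- The factor `1 - σ D` has values in `ker D`, which equals the range of `D` by acyclicity, and
  -- there `D σ` is the identity.
  refine ⟨σ ∘ₗ (LinearMap.id - σ ∘ₗ D), fun x => ?_⟩
  obtain ⟨y, hy⟩ := hD (x - σ (D x)) (by rw [map_sub, hσ', sub_self])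
  simp only [LinearMap.comp_apply, LinearMap.sub_apply, LinearMap.id_apply, hDD, map_zero,
    sub_zero]
  rw [← hy, hσ', hy, sub_add_cancel]

/-! ### Homogeneous components of linear maps. -/

section homogenize

variable {A : DGAlgebra.{u, v} K} {B : DGAlgebra.{u, w} K}

/-- The component of degree `e` of a linear map. -/
noncomputable def homogenize (e : ℤ) (T : A →ₗ[K] B) : A →ₗ[K] B :=
  DirectSum.toModule K ℤ B (fun n => B.proj (n + e) ∘ₗ T ∘ₗ (A.grading n).subtype) ∘ₗ
    (DirectSum.decomposeLinearEquiv A.grading).toLinearMap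

theorem homogenize_apply (e : ℤ) (T : A →ₗ[K] B) {n : ℤ} {a : A} (ha : a ∈ A.grading n) :
    homogenize e T a = B.proj (n + e) (T a) := by
  have h := DirectSum.decomposeLinearEquiv_apply_coe (R := K) A.grading n ⟨a, ha⟩
  simp only at h
  simp only [homogenize, LinearMap.comp_apply, LinearEquiv.coe_coe, h, DirectSum.toModule_lof]
  rfl

theorem Hom.map_proj (f : A.Hom B) (n : ℤ) (a : A) :
    f.toAlgHom (A.proj n a) = B.proj n (f.toAlgHom a) := by
  induction a using A.induction with
  | h0 => simp
  | hadd a a' h h' => simp [h, h']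
  | hh m a ha =>
    by_cases h : m = n
    · subst h
      rw [A.proj_same ha, B.proj_same (f.map_mem m a ha)]
    · rw [A.proj_ne h ha, B.proj_ne h (f.map_mem m a ha), map_zero]

end homogenize

/-- A linear map is homogeneous of degree `e`. -/
def HasDegree {A : DGAlgebra.{u, v} K} {B : DGAlgebra.{u, w} K} (e : ℤ) (T : A →ₗ[K] B) : Prop :=
  ∀ (n : ℤ) (a : A), a ∈ A.grading n → T a ∈ B.grading (n + e)

theorem homogenize_hasDegree {A : DGAlgebra.{u, v} K} {B : DGAlgebra.{u, w} K} (e : ℤ)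
    (T : A →ₗ[K] B) : HasDegree e (homogenize e T) := by
  intro n a ha
  rw [homogenize_apply e T ha]
  exact B.proj_mem _ _

/-- A homotopy inverse of a homomorphism, as a map of complexes. -/
structure HomotopyInverse {A : DGAlgebra.{u, v} K} {B : DGAlgebra.{u, w} K} (f : A.Hom B) where
  inv : B →ₗ[K] A
  left : A →ₗ[K] A
  right : B →ₗ[K] B
  inv_mem : HasDegree 0 inv
  left_mem : HasDegree (-1) left
  right_mem : HasDegree (-1) right
  inv_d : ∀ b, inv (B.d b) = A.d (inv b)
  left_eq : ∀ a, A.d (left a) + left (A.d a) = inv (f.toAlgHom a) - a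
  right_eq : ∀ b, B.d (right b) + right (B.d b) = f.toAlgHom (inv b) - b

variable {A : DGAlgebra.{u, v} K} {B : DGAlgebra.{u, w} K}

theorem Hom.cohomologyMap_class (f : A.Hom B) (z : A.cocycles)
    (hz : f.toAlgHom z ∈ B.cocycles) :
    f.cohomologyMap (A.cohomologyClass z) = B.cohomologyClass ⟨f.toAlgHom z, hz⟩ := rfl

theorem Hom.map_mem_cocycles (f : A.Hom B) {z : A} (hz : z ∈ A.cocycles) :
    f.toAlgHom z ∈ B.cocycles := by
  rw [mem_cocycles] at *
  rw [← f.map_d, hz, map_zero]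

theorem class_eq_zero_iff {z : A.cocycles} : A.cohomologyClass z = 0 ↔ ∃ a, A.d a = z :=
  Ideal.Quotient.eq_zero_iff_mem

/-- The mapping cone is exact: injectivity on cohomology makes `a` a coboundary, and surjectivity
then corrects the primitive by a cocycle. -/
theorem Hom.IsQuasiIso.cone_exact {f : A.Hom B} (hf : f.IsQuasiIso) {a : A} {b : B}
    (ha : A.d a = 0) (hab : f.toAlgHom a = B.d b) :
    ∃ x w, A.d x = a ∧ f.toAlgHom x - b = B.d w := by
  have h0 : A.cohomologyClass ⟨a, ha⟩ = 0 := by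
    apply hf.1
    rw [map_zero, f.cohomologyMap_class _ (f.map_mem_cocycles (z := a) ha)]
    exact class_eq_zero_iff.2 ⟨b, hab.symm⟩
  obtain ⟨x, hx : A.d x = a⟩ := class_eq_zero_iff.1 h0
  have hc : f.toAlgHom x - b ∈ B.cocycles := by
    rw [mem_cocycles, map_sub, ← f.map_d, hx, hab, sub_self]
  obtain ⟨y, hy⟩ := hf.2 (B.cohomologyClass ⟨_, hc⟩)
  obtain ⟨y, rfl⟩ := Ideal.Quotient.mkₐ_surjective K _ y
  have hy' := f.cohomologyMap_class y (f.map_mem_cocycles y.2)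
  rw [hy, ← sub_eq_zero, ← map_sub] at hy'
  obtain ⟨w, hw : B.d w = f.toAlgHom x - b - f.toAlgHom y⟩ := class_eq_zero_iff.1 hy'
  have hyd : A.d y = 0 := y.2
  refine ⟨x - y, w, by rw [map_sub, hx, hyd, sub_zero], ?_⟩
  rw [hw, map_sub]
  abel

/-- A contraction of the mapping cone contains all the data: its entry `B → A` is a homotopy
inverse, and its diagonal entries are the homotopies up to sign. The contraction is found without
regard to the grading, and the components of the right degrees are taken afterwards. -/
theorem Hom.IsQuasiIso.nonempty_homotopyInverse {f : A.Hom B} (hf : f.IsQuasiIso) :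
    Nonempty (HomotopyInverse f) := by
  let D : (A × B) →ₗ[K] (A × B) :=
    (A.d ∘ₗ LinearMap.fst K A B).prod
      (f.toAlgHom.toLinearMap ∘ₗ LinearMap.fst K A B - B.d ∘ₗ LinearMap.snd K A B)
  have hD : ∀ a b, D (a, b) = (A.d a, f.toAlgHom a - B.d b) := fun _ _ => rfl
  obtain ⟨k, hk⟩ := exists_contraction D
    (by
      rintro ⟨a, b⟩
      rw [hD, hD, A.d_d, map_sub, B.d_d, f.map_d]
      simp)
    (by
      rintro ⟨a, b⟩ h
      rw [hD, Prod.mk_eq_zero, sub_eq_zero] at h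
      obtain ⟨x, w, hx, hw⟩ := hf.cone_exact h.1 h.2
      refine ⟨(x, w), ?_⟩
      rw [hD, hx, ← hw, sub_sub_cancel])
  -- Entries of the contraction as a block matrix; the entry `A → B` is not needed.
  let α : A →ₗ[K] A := LinearMap.fst K A B ∘ₗ k ∘ₗ LinearMap.inl K A B
  let β : B →ₗ[K] A := LinearMap.fst K A B ∘ₗ k ∘ₗ LinearMap.inr K A B
  let δ : B →ₗ[K] B := LinearMap.snd K A B ∘ₗ k ∘ₗ LinearMap.inr K A B
  have hkadd : ∀ a b, k (a, b) = k (a, 0) + k (0, b) := fun a b => by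
    rw [← map_add]; simp
  have hneg : ∀ b, k (0, -b) = -k (0, b) := fun b => by
    rw [← map_neg, Prod.neg_mk, neg_zero]
  have hleft : ∀ a, A.d (α a) + (α (A.d a) + β (f.toAlgHom a)) = a := by
    intro a
    have := congrArg Prod.fst (hk (a, 0))
    rw [hD a 0, map_zero, sub_zero, hkadd (A.d a)] at this
    exact this
  have hinv : ∀ b, β (B.d b) = A.d (β b) := by
    intro b
    have := congrArg Prod.fst (hk (0, b))
    rw [hD 0 b, map_zero, map_zero, zero_sub, hneg] at this
    exact (add_neg_eq_zero.1 this).symm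
  have hright : ∀ b, f.toAlgHom (β b) - B.d (δ b) + -δ (B.d b) = b := by
    intro b
    have := congrArg Prod.snd (hk (0, b))
    rw [hD 0 b, map_zero, map_zero, zero_sub, hneg] at this
    exact this
  -- The sign on `α` turns `d α + α d + β f = 1` into the required form; for `δ` the sign of `d` on
  -- the summand `B` of the cone already does this.
  refine ⟨⟨homogenize 0 β, -homogenize (-1) α, homogenize (-1) δ, homogenize_hasDegree _ _,
    fun n a ha => neg_mem (homogenize_hasDegree _ _ n a ha), homogenize_hasDegree _ _, ?_, ?_, ?_⟩⟩
  · intro b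
    induction b using B.induction with
    | h0 => simp
    | hadd a a' h h' => simp only [map_add, h, h']
    | hh n b hb =>
      rw [homogenize_apply _ _ hb, homogenize_apply _ _ (B.d_mem n b hb), hinv, d_proj]
      congr 2
      ring
  · intro b
    induction b using A.induction with
    | h0 => simp
    | hadd a a' h h' =>
      simp only [map_add] at h h' ⊢
      rw [add_sub_add_comm, ← h, ← h']
      abel
    | hh n b hb =>
      have := congrArg (A.proj n) (hleft b)
      rw [A.proj_same hb, map_add, map_add] at this
      rw [LinearMap.neg_apply, LinearMap.neg_apply, homogenize_apply _ _ hb,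
        homogenize_apply _ _ (A.d_mem n b hb), homogenize_apply _ _ (f.map_mem n b hb),
        map_neg, d_proj, add_neg_cancel_right, neg_add_cancel_right, add_zero]
      nth_rw 4 [← this]
      abel
  · intro b
    induction b using B.induction with
    | h0 => simp
    | hadd a a' h h' =>
      simp only [map_add] at h h' ⊢
      rw [add_sub_add_comm, ← h, ← h']
      abel
    | hh n b hb =>
      have := congrArg (B.proj n) (hright b)
      rw [B.proj_same hb, map_add, map_sub, map_neg] at this
      rw [homogenize_apply _ _ hb, homogenize_apply _ _ hb,
        homogenize_apply _ _ (B.d_mem n b hb), f.map_proj,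
        d_proj, add_neg_cancel_right, neg_add_cancel_right, add_zero]
      nth_rw 4 [← this]
      abel

end DGAlgebra

/-! ### Koszul signs of homogeneous linear maps. -/

namespace DGAlgebra

variable {K : Type u} [Field K]

theorem koszul_one_koszul_one (A : DGAlgebra.{u, w} K) (a : A) :
    A.koszul 1 (A.koszul 1 a) = a := by
  rw [koszul_koszul, koszul_add_self]

theorem HasDegree.koszul {A : DGAlgebra.{u, v} K} {B : DGAlgebra.{u, w} K} {e : ℤ}
    {T : A →ₗ[K] B} (hT : HasDegree e T) (a : A) :
    B.koszul 1 (T a) = (-1 : K) ^ e • T (A.koszul 1 a) := by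
  induction a using A.induction with
  | h0 => simp
  | hadd a a' h h' => simp [h, h']
  | hh n a ha =>
    rw [A.koszul_apply 1 ha, B.koszul_apply 1 (hT n a ha), map_smul, smul_smul, one_mul, one_mul,
      zpow_add₀ (by simp), mul_comm]

theorem Hom.hasDegree {A : DGAlgebra.{u, v} K} {B : DGAlgebra.{u, w} K} (f : A.Hom B) :
    HasDegree 0 f.toAlgHom.toLinearMap := by
  intro n a ha
  rw [add_zero]
  exact f.map_mem n a ha

end DGAlgebra

/-! ### Functoriality of the bicomplex in the coefficients and in the algebra. -/

namespace DGAlgebra.Rel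

variable {K : Type u} [Field K] {A : DGAlgebra.{u, v} K} {B : DGAlgebra.{u, w} K}
  {C : DGAlgebra.{u, w'} K} {s : ℕ}

/-- The Hochschild bicomplex of a homomorphism. -/
noncomputable def bicomplex (f : A.Hom B) : ColumnBicomplex K where
  X s := Multi A B s
  homog s := homogeneous s
  dv _ := internalD
  dh _ := hochschildD f
  dh_mem := hochschildD_mem f
  dh_dh _ := hochschildD_hochschildD f
  dh_dv := hochschildD_internalD f

/-- Composition with a linear map on the left. -/
def postcomp (s : ℕ) (T : B →ₗ[K] C) : Multi A B s →ₗ[K] Multi A C s where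
  toFun φ := T.compMultilinearMap φ
  map_add' φ ψ := by ext; simp
  map_smul' c φ := by ext; simp

theorem postcomp_apply (T : B →ₗ[K] C) (φ : Multi A B s) (a : Fin s → A) :
    postcomp s T φ a = T (φ a) := rfl

theorem postcomp_mem {e : ℤ} {T : B →ₗ[K] C} (hT : HasDegree e T) {t : ℤ} {φ : Multi A B s}
    (h : φ ∈ homogeneous s t) : postcomp s T φ ∈ homogeneous s (t + e) := by
  intro n a ha
  rw [← add_assoc]
  exact hT _ _ (h n a ha)

theorem postcomp_internalD {T : B →ₗ[K] C} (hT : ∀ b, T (B.d b) = C.d (T b)) (t : ℤ)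
    (φ : Multi A B s) : postcomp s T (internalD t φ) = internalD t (postcomp s T φ) := by
  ext a
  simp only [postcomp_apply, internalD_apply, map_sub, map_smul, map_sum, hT]

/-- The terms with `d` on the arguments carry `(-1) ^ t` and `(-1) ^ (t + 1)` and cancel, which
leaves the commutator of `u` with the differential of `B`. -/
theorem postcomp_homotopy (u : B →ₗ[K] B) (t : ℤ) (φ : Multi A B s) :
    internalD t (postcomp s u φ) + postcomp s u (internalD (t + 1) φ) =
      postcomp s (B.d ∘ₗ u + u ∘ₗ B.d) φ := by
  ext a
  simp only [postcomp_apply, internalD_apply, map_sub, map_neg, map_smul, map_sum, add_apply,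
    LinearMap.add_apply, LinearMap.comp_apply, zpow_add₀ (show (-1 : K) ≠ 0 by simp), zpow_one,
    mul_neg_one, neg_smul]
  abel

theorem postcomp_hochschildD (f : A.Hom B) (g : B.Hom C) (h : A.Hom C)
    (hfg : ∀ a, h.toAlgHom a = g.toAlgHom (f.toAlgHom a)) (t : ℤ)
    (φ : Multi A B s) : postcomp (s + 1) g.toAlgHom.toLinearMap (hochschildD f t φ) =
      hochschildD h t (postcomp s g.toAlgHom.toLinearMap φ) := by
  ext a
  simp only [postcomp_apply, hochschildD_apply, AlgHom.toLinearMap_apply, map_add, map_smul,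
    map_sum, map_mul, hfg, g.map_koszul]

/-- Inside one column the multiplication plays no role, so the linear homotopy inverse and its
homotopies act by postcomposition. -/
theorem coneAcyclic_postcomp {f : A.Hom B} (h : HomotopyInverse f) (s : ℕ) :
    ColumnBicomplex.ConeAcyclic (D := bicomplex (Hom.id A)) (E := bicomplex f) s
      (postcomp s f.toAlgHom.toLinearMap) := by
  refine ColumnBicomplex.coneAcyclic_of_homotopy (D := bicomplex (Hom.id A)) (E := bicomplex f)
    (postcomp s f.toAlgHom.toLinearMap) (postcomp s h.inv) (fun _ => postcomp s h.left)
    (fun _ => postcomp s h.right) ?_ ?_ ?_ ?_ ?_ ?_ ?_ ?_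
  · exact postcomp_internalD f.map_d
  · exact postcomp_internalD h.inv_d
  · intro t x hx
    have := postcomp_mem f.hasDegree hx
    rwa [add_zero] at this
  · intro t x hx
    have := postcomp_mem h.inv_mem hx
    rwa [add_zero] at this
  · intro t x hx
    have := postcomp_mem h.left_mem hx
    rwa [add_neg_cancel_right] at this
  · intro t x hx
    have := postcomp_mem h.right_mem hx
    rwa [add_neg_cancel_right] at this
  · intro t x _
    refine (postcomp_homotopy h.left t x).trans ?_
    exact MultilinearMap.ext fun a => h.left_eq (DFunLike.coe (F := Multi A A s) x a)
  · intro t x _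
    refine (postcomp_homotopy h.right t x).trans ?_
    exact MultilinearMap.ext fun a => h.right_eq (DFunLike.coe (F := Multi A B s) x a)

/-- Composition with a linear map in each argument. -/
def precomp (s : ℕ) (T : A →ₗ[K] B) : Multi B C s →ₗ[K] Multi A C s where
  toFun φ := φ.compLinearMap fun _ => T
  map_add' φ ψ := by ext; simp
  map_smul' c φ := by ext; simp

theorem precomp_apply (T : A →ₗ[K] B) (φ : Multi B C s) (a : Fin s → A) :
    precomp s T φ a = φ (fun i => T (a i)) := rfl

theorem precomp_mem {T : A →ₗ[K] B} (hT : HasDegree 0 T) {t : ℤ} {φ : Multi B C s}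
    (h : φ ∈ homogeneous s t) : precomp s T φ ∈ homogeneous s t := by
  intro n a ha
  refine h n _ fun i => ?_
  have := hT _ _ (ha i)
  rwa [add_zero] at this

theorem map_slot {T : A →ₗ[K] B} (hT : HasDegree 0 T) (hd : ∀ a, T (A.d a) = B.d (T a))
    (i j : Fin s) (a : A) : T (A.slot i j a) = B.slot i j (T a) := by
  unfold slot
  split_ifs
  · rw [hT.koszul, zpow_zero, one_smul]
  · exact hd a
  · rfl

theorem precomp_internalD {T : A →ₗ[K] B} (hT : HasDegree 0 T)
    (hd : ∀ a, T (A.d a) = B.d (T a)) (t : ℤ) (φ : Multi B C s) :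
    precomp s T (internalD t φ) = internalD t (precomp s T φ) := by
  ext a
  simp only [precomp_apply, internalD_apply, map_slot hT hd]

theorem precomp_hochschildD (f : A.Hom B) (g : B.Hom C) (h : A.Hom C)
    (hfg : ∀ a, h.toAlgHom a = g.toAlgHom (f.toAlgHom a)) (t : ℤ)
    (φ : Multi B C s) : precomp (s + 1) f.toAlgHom.toLinearMap (hochschildD g t φ) =
      hochschildD h t (precomp s f.toAlgHom.toLinearMap φ) := by
  ext a
  simp only [precomp_apply, hochschildD_apply, AlgHom.toLinearMap_apply, hfg]
  congr 3
  refine funext fun i => ?_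
  congr 2
  funext k
  unfold Fin.contractNth
  split_ifs
  · rfl
  · exact (map_mul f.toAlgHom _ _).symm
  · rfl

/-- The factors of the homotopy on tensor powers that is induced by a homotopy `u` from the identity
to `p`. -/
noncomputable def homotopySlot (u p : A →ₗ[K] A) (i j : Fin s) : A →ₗ[K] A :=
  if j < i then p ∘ₗ A.koszul 1 else if j = i then u else LinearMap.id

/-- Precomposition with the homotopy on tensor powers that is induced by a homotopy `u` from the
identity to `p`. -/
noncomputable def precompHomotopy (s : ℕ) (u p : A →ₗ[K] A) : Multi A B s →ₗ[K] Multi A B s where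
  toFun φ := ∑ i : Fin s, φ.compLinearMap (homotopySlot u p i)
  map_add' φ ψ := by ext; simp [Finset.sum_add_distrib]
  map_smul' c φ := by ext; simp [Finset.smul_sum]

theorem precompHomotopy_apply (u p : A →ₗ[K] A) (φ : Multi A B s) (a : Fin s → A) :
    precompHomotopy s u p φ a = ∑ i, φ (fun j => homotopySlot u p i j (a j)) := by
  simp [precompHomotopy]

theorem precompHomotopy_mem {u p : A →ₗ[K] A} (hu : HasDegree (-1) u) (hp : HasDegree 0 p) {t : ℤ}
    {φ : Multi A B s} (h : φ ∈ homogeneous s (t + 1)) :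
    precompHomotopy s u p φ ∈ homogeneous s t := by
  intro n a ha
  rw [precompHomotopy_apply]
  refine Submodule.sum_mem _ fun i _ => ?_
  have := h (n + Pi.single i (-1)) (fun j => homotopySlot u p i j (a j)) (fun j => by
    unfold homotopySlot
    split_ifs with h h'
    · have := hp _ _ (A.koszul_mem 1 (ha j))
      simpa [h.ne] using this
    · subst h'; simpa using hu _ _ (ha j)
    · simpa [h'] using ha j)
  simp only [Pi.add_apply, Finset.sum_add_distrib, Finset.sum_pi_single', Finset.mem_univ,
    if_true] at this
  convert this using 2
  ring

/-! ### The homotopy between `p ⊗ ⋯ ⊗ p` and the identity. -/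

section

variable {u p : A →ₗ[K] A} (hu : HasDegree (-1) u) (hp : HasDegree 0 p)
  (hpu : ∀ a, A.d (u a) + u (A.d a) = p a - a)

include hu hp hpu in
-- Odd operators on different tensor factors anticommute. The two orders of composition differ only
-- at the smaller of the two positions, where an odd operator meets the parity automorphism. At that
-- position `p` must also commute with `d`, which follows from `hpu`.
theorem homotopySlot_slot (φ : Multi A B s) (a : Fin s → A) {i j : Fin s} (hij : i ≠ j) :
    φ (fun k => homotopySlot u p j k (A.slot i k (a k))) =
      -φ (fun k => A.slot i k (homotopySlot u p j k (a k))) := by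
  have hκu : ∀ x, u (A.koszul 1 x) = -A.koszul 1 (u x) := by
    intro x
    rw [hu.koszul]
    simp
  have hκp : ∀ x, p (A.koszul 1 x) = A.koszul 1 (p x) := by
    intro x
    rw [hp.koszul, zpow_zero, one_smul]
  have hdp : ∀ x, p (A.d x) = A.d (p x) := by
    intro x
    have h1 := hpu (A.d x)
    have h2 := congrArg A.d (hpu x)
    rw [A.d_d, map_zero, add_zero] at h1
    rw [map_add, A.d_d, zero_add, map_sub, h1] at h2
    exact sub_left_injective h2
  have h : (fun k => homotopySlot u p j k (A.slot i k (a k))) =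
      Function.update (fun k => A.slot i k (homotopySlot u p j k (a k))) (min i j)
        ((-1 : K) • A.slot i (min i j) (homotopySlot u p j (min i j) (a (min i j)))) := by
    funext k
    by_cases hk : k = min i j
    · rw [hk, Function.update_self]
      rcases lt_or_gt_of_ne hij with h | h
      · rw [min_eq_left h.le]
        simp [homotopySlot, slot, h, hκp, hdp, d_koszul]
      · rw [min_eq_right h.le]
        simp [homotopySlot, slot, h, hκu]
    · rw [Function.update_of_ne hk]
      unfold slot homotopySlot
      split_ifs <;> first
        | rfl
        | (simp only [LinearMap.comp_apply, hκp]; done)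
        | (exfalso; apply hk; rcases lt_or_gt_of_ne hij with h | h <;>
            [rw [min_eq_left h.le]; rw [min_eq_right h.le]] <;> omega)
  rw [h, MultilinearMap.map_update_smul, Function.update_eq_self, neg_one_smul]

include hpu hp in
-- On the factor `i` the sum is `d u + u d = p - 1`. On earlier factors the two parity automorphisms
-- cancel and leave `p`. The right side is written as a difference of consecutive terms so that it
-- telescopes over `i`.
theorem homotopySlot_slot_self (φ : Multi A B s) (a : Fin s → A) (i : Fin s) :
    φ (fun k => homotopySlot u p i k (A.slot i k (a k))) +
      φ (fun k => A.slot i k (homotopySlot u p i k (a k))) =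
    φ (fun k => if (k : ℕ) < i + 1 then p (a k) else a k) -
      φ (fun k => if (k : ℕ) < i then p (a k) else a k) := by
  have hκp : ∀ x, A.koszul 1 (p (A.koszul 1 x)) = p x := by
    intro x
    rw [hp.koszul, zpow_zero, one_smul, koszul_one_koszul_one]
  -- All four argument tuples have `p` before position `i` and nothing after it, so they differ only
  -- in the entry at `i` and additivity in that slot applies.
  have h1 : ∀ (b : Fin s → A) (x : A), b i = x → (∀ k < i, b k = p (a k)) →
      (∀ k, i < k → b k = a k) →
      b = Function.update (fun k : Fin s => if (k : ℕ) < i then p (a k) else a k) i x := by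
    rintro b x hx hb hb'
    funext k
    rcases lt_trichotomy k i with hk | hk | hk
    · rw [Function.update_of_ne hk.ne, hb k hk]
      exact (if_pos (show (k : ℕ) < i from hk)).symm
    · rw [hk, hx, Function.update_self]
    · rw [Function.update_of_ne hk.ne', hb' k hk]
      exact (if_neg (by omega)).symm
  rw [h1 (fun k => homotopySlot u p i k (A.slot i k (a k))) (u (A.d (a i)))
      (by simp [homotopySlot, slot])
      (fun k hk => by simp [homotopySlot, slot, hk, koszul_one_koszul_one])
      (fun k hk => by simp [homotopySlot, slot, hk.not_gt, hk.ne']),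
    h1 (fun k => A.slot i k (homotopySlot u p i k (a k))) (A.d (u (a i)))
      (by simp [homotopySlot, slot])
      (fun k hk => by simp [homotopySlot, slot, hk, hκp])
      (fun k hk => by simp [homotopySlot, slot, hk.not_gt, hk.ne']),
    h1 (fun k => if (k : ℕ) < i + 1 then p (a k) else a k) (p (a i)) (by simp)
      (fun k hk => if_pos (by omega)) (fun k hk => if_neg (by omega)),
    h1 (fun k => if (k : ℕ) < i then p (a k) else a k) (a i) (by simp)
      (fun k hk => if_pos hk) (fun k hk => if_neg (by omega)),
    ← φ.map_update_add, add_comm, hpu, φ.map_update_sub]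
  simp only [Function.update_idem]

include hu hp hpu in
-- In the double sum the off-diagonal terms cancel in pairs, and the diagonal ones telescope from no
-- `p` to `p` on every factor.
theorem precompHomotopy_precompD (φ : Multi A B s) :
    precompD (precompHomotopy s u p φ) + precompHomotopy s u p (precompD φ) =
      precomp s p φ - φ := by
  ext a
  simp only [add_apply, sub_apply, precompD_apply, precompHomotopy_apply, precomp_apply]
  rw [Finset.sum_comm (f := fun i j => φ fun k => A.slot j k (homotopySlot u p i k (a k))),
    ← Finset.sum_add_distrib]
  have h : ∀ i : Fin s, (∑ j, φ fun k => homotopySlot u p j k (A.slot i k (a k))) +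
      (∑ j, φ fun k => A.slot i k (homotopySlot u p j k (a k))) =
      φ (fun k => if (k : ℕ) < i + 1 then p (a k) else a k) -
        φ (fun k => if (k : ℕ) < i then p (a k) else a k) := by
    intro i
    rw [← homotopySlot_slot_self hp hpu, ← Finset.sum_add_distrib]
    refine Finset.sum_eq_single i (fun j _ hj => ?_) (by simp)
    rw [homotopySlot_slot hu hp hpu φ a hj.symm, neg_add_cancel]
  rw [Finset.sum_congr rfl fun i _ => h i, Fin.sum_univ_eq_sum_range (fun i =>
      φ (fun k : Fin s => if (k : ℕ) < i + 1 then p (a k) else a k) -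
        φ (fun k : Fin s => if (k : ℕ) < i then p (a k) else a k)),
    Finset.sum_range_sub (fun i => φ (fun k : Fin s => if (k : ℕ) < i then p (a k) else a k))]
  simp

include hu hp hpu in
-- The sign `(-1) ^ t` absorbs the sign with which precomposition enters the internal differential,
-- and makes the terms with `d` on the values cancel.
theorem precomp_homotopy (t : ℤ) (φ : Multi A B s) :
    internalD t ((-1 : K) ^ (t + 1) • precompHomotopy s u p φ) +
      (-1 : K) ^ (t + 1 + 1) • precompHomotopy s u p (internalD (t + 1) φ) =
      precomp s p φ - φ := by
  rw [← precompHomotopy_precompD hu hp hpu]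
  ext a
  have h : (-1 : K) ^ t * (-1 : K) ^ t = 1 := neg_one_zpow_mul_self t
  simp only [precompHomotopy_apply, internalD_apply, map_smul, add_apply,
    smul_apply, precompD_apply, zpow_add₀ (show (-1 : K) ≠ 0 by simp), zpow_one,
    Finset.sum_sub_distrib, smul_sub, ← Finset.smul_sum, map_sum, smul_smul,
    mul_one, neg_neg, mul_neg, h, neg_smul, one_smul, neg_apply, map_neg, Finset.sum_neg_distrib,
    smul_neg]
  abel

end

/-- Precomposition is contravariant, so the homotopy on `B` serves the source bicomplex and the
homotopy on `A` the target. -/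
theorem coneAcyclic_precomp {f : A.Hom B} (h : HomotopyInverse f) (s : ℕ) :
    ColumnBicomplex.ConeAcyclic (D := bicomplex (Hom.id B)) (E := bicomplex f) s
      (precomp s f.toAlgHom.toLinearMap) := by
  have hp : HasDegree 0 (h.inv ∘ₗ f.toAlgHom.toLinearMap) := fun n a ha => by
    have := h.inv_mem _ _ (f.hasDegree _ _ ha)
    rwa [add_zero] at this
  have hp' : HasDegree 0 (f.toAlgHom.toLinearMap ∘ₗ h.inv) := fun n a ha => by
    have := f.hasDegree _ _ (h.inv_mem _ _ ha)
    rwa [add_zero] at this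
  refine ColumnBicomplex.coneAcyclic_of_homotopy (D := bicomplex (Hom.id B)) (E := bicomplex f)
    (precomp s f.toAlgHom.toLinearMap) (precomp s h.inv)
    (fun t => (-1 : K) ^ t • precompHomotopy s h.right (f.toAlgHom.toLinearMap ∘ₗ h.inv))
    (fun t => (-1 : K) ^ t • precompHomotopy s h.left (h.inv ∘ₗ f.toAlgHom.toLinearMap))
    ?_ ?_ ?_ ?_ ?_ ?_ ?_ ?_
  · exact precomp_internalD f.hasDegree f.map_d
  · exact precomp_internalD h.inv_mem h.inv_d
  · exact fun t x hx => precomp_mem f.hasDegree hx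
  · exact fun t x hx => precomp_mem h.inv_mem hx
  · exact fun t x hx => Submodule.smul_mem _ _ (precompHomotopy_mem h.right_mem hp' hx)
  · exact fun t x hx => Submodule.smul_mem _ _ (precompHomotopy_mem h.left_mem hp hx)
  · exact fun t x _ => precomp_homotopy h.right_mem hp' h.right_eq t x
  · exact fun t x _ => precomp_homotopy h.left_mem hp h.left_eq t x

end DGAlgebra.Rel

/-! ### Graded commutativity of the cup product in cohomology -/

namespace SimplicialCochains

variable {S : SSet.{v}}

/-- For `q = 0` the vertex `i` is repeated, so that monotonicity is only weak and the simplex is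
degenerate. -/
theorem join_mono (i q : ℕ) : Monotone (fun m : ℕ => if m ≤ i then m else m + q - 1) := by
  intro a b h
  dsimp only
  split_ifs <;> omega

/-- The simplex with the vertices `0, …, i` and `i + q, …` of a given simplex. -/
def join (x : Simplices S) (i q : ℕ) : Simplices S :=
  pull x (x.1 + 1 - q) _ (join_mono i q)

theorem join_dim (x : Simplices S) (i q : ℕ) : (join x i q).1 = x.1 + 1 - q := rfl

/-! ### Faces of the two simplices that occur in the cup-`1` product. -/

section

variable (x : Simplices S) {i k p q : ℕ} (hx : x.1 = p + q) (hi : i < p)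

include hx hi

/-- The omitted vertex `k` lies before, inside or after the block `i + 1, …, i + q`. Before it, the
index `i` moves to `i + 1`; inside it, the joined simplex no longer depends on `k`; after it, the
segment no longer does. -/
theorem join_face_front (hk : k ≤ i) : join (face x k) i q = face (join x (i + 1) q) k := by
  unfold face join
  rw [pull_pull, pull_pull]
  refine pull_congr _ _ _ (by simp only [pull]; omega) fun j hj => ?_
  simp only [pull] at hj ⊢
  split_ifs <;> omega

theorem join_face_middle (hk : i < k) (hk' : k ≤ i + q) :
    join (face x k) i q = face (join x i q) (i + 1) := by
  unfold face join
  rw [pull_pull, pull_pull]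
  refine pull_congr _ _ _ (by simp only [pull]; omega) fun j hj => ?_
  simp only [pull] at hj ⊢
  split_ifs <;> omega

theorem join_face_back (r : ℕ) :
    join (face x (i + q + 1 + r)) i q = face (join x i q) (i + 2 + r) := by
  unfold face join
  rw [pull_pull, pull_pull]
  refine pull_congr _ _ _ (by simp only [pull]; omega) fun j hj => ?_
  simp only [pull] at hj ⊢
  split_ifs <;> omega

/-- This common face links the summands `i` and `i + 1` of the cup-`1` product and makes its
coboundary telescope. -/
theorem face_join_succ : face (join x (i + 1) q) (i + 1) = face (join x i q) (i + 1) := by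
  unfold face join
  rw [pull_pull, pull_pull]
  refine pull_congr _ _ _ rfl fun j hj => ?_
  change j ≤ x.1 + 1 - q - 1 at hj
  split_ifs <;> omega

theorem seg_face_low (hk : k ≤ i) :
    seg (face x k) i (i + q) = seg x (i + 1) (i + 1 + q) := by
  unfold face seg
  rw [pull_pull]
  refine pull_congr _ _ _ (by omega) fun j hj => ?_
  split_ifs <;> omega

theorem seg_face_middle (r : ℕ) (hr : r < q) :
    seg (face x (i + 1 + r)) i (i + q) = face (seg x i (i + q + 1)) (r + 1) := by
  unfold face seg
  rw [pull_pull, pull_pull]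
  refine pull_congr _ _ _ (by simp only [pull]; omega) fun j hj => ?_
  change j ≤ i + q - i at hj
  split_ifs <;> omega

theorem seg_face_high (hk : i + q < k) : seg (face x k) i (i + q) = seg x i (i + q) := by
  unfold face seg
  rw [pull_pull]
  refine pull_congr _ _ _ (by omega) fun j hj => ?_
  split_ifs <;> omega

theorem face_seg_zero : face (seg x i (i + q + 1)) 0 = seg x (i + 1) (i + 1 + q) := by
  unfold face seg
  rw [pull_pull]
  refine pull_congr _ _ _ (by simp only [pull]; omega) fun j hj => ?_
  simp only [pull] at hj ⊢
  split_ifs <;> omega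

theorem face_seg_last : face (seg x i (i + q + 1)) (q + 1) = seg x i (i + q) := by
  unfold face seg
  rw [pull_pull]
  refine pull_congr _ _ _ (by simp only [pull]; omega) fun j hj => ?_
  simp only [pull] at hj ⊢
  split_ifs <;> omega

end

theorem face_join_zero (x : Simplices S) {p q : ℕ} (hx : x.1 = p + q) :
    face (join x 0 q) 0 = seg x q x.1 := by
  unfold face join seg
  rw [pull_pull]
  refine pull_congr _ _ _ (by simp only [pull]; omega) fun j hj => ?_
  simp only [pull] at hj ⊢
  split_ifs <;> omega

theorem face_join_last (x : Simplices S) {p q : ℕ} (hx : x.1 = p + q) :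
    face (join x p q) (p + 1) = seg x 0 p := by
  unfold face join seg
  rw [pull_pull]
  refine pull_congr _ _ _ (by simp only [pull]; omega) fun j hj => ?_
  simp only [pull] at hj ⊢
  split_ifs <;> omega

variable {K : Type u} [Field K]

/-- The cup-`1` product of a `p`-cochain and a `q`-cochain. -/
def cupOne (p q : ℕ) (f g : Simplices S → K) (x : Simplices S) : K :=
  if x.1 + 1 = p + q then
    ∑ i ∈ Finset.range p, ((-1 : K) ^ (q + 1)) ^ i * (f (join x i q) * g (seg x i (i + q)))
  else 0

/-- The alternating sum of the values of `f` on the faces of `join x i q` that omit one of the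
vertices `0, …, i`. -/
def frontSum (q : ℕ) (f : Simplices S → K) (x : Simplices S) (i : ℕ) : K :=
  ∑ k ∈ Finset.range (i + 1), (-1 : K) ^ k * f (face (join x i q) k)

/-! ### The coboundary of the cup-`1` product of two cocycles. -/

section

variable {f g : Simplices S → K} (hf : coboundary f = 0) (hg : coboundary g = 0)
  (x : Simplices S) {i p q : ℕ} (hx : x.1 = p + q)

include hf hx in
-- The cocycle condition for `f` on `join x i q`, split after the vertex `i`.
theorem frontSum_add_eq_zero (hi : i ≤ p) : frontSum q f x i +
    ∑ r ∈ Finset.range (p + 1 - i), (-1 : K) ^ (i + 1 + r) * f (face (join x i q) (i + 1 + r)) = 0 := by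
  have h := congrFun hf (join x i q)
  rw [coboundary_of_dim_succ f _ (n := p) (by rw [join_dim]; omega)] at h
  rw [show p + 2 = (i + 1) + (p + 1 - i) by omega, Finset.sum_range_add] at h
  exact h

include hf hg hx in
-- This is the contribution of one summand of the cup-`1` product to its coboundary. The two cocycle
-- conditions remove the faces inside and behind the block, and what is left is a difference of
-- consecutive terms twisted by `(-1) ^ (q + 1)`.
theorem sum_faces_cupOne (hi : i < p) :
    ∑ k ∈ Finset.range (p + q + 1),
      (-1 : K) ^ k * (f (join (face x k) i q) * g (seg (face x k) i (i + q))) =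
    frontSum q f x (i + 1) * g (seg x (i + 1) (i + 1 + q)) -
      (-1 : K) ^ (q + 1) * (frontSum q f x i * g (seg x i (i + q))) := by
  have e1 : ∀ k ∈ Finset.range (i + 1),
      (-1 : K) ^ k * (f (join (face x k) i q) * g (seg (face x k) i (i + q))) =
      (-1 : K) ^ k * f (face (join x (i + 1) q) k) * g (seg x (i + 1) (i + 1 + q)) := by
    intro k hk
    rw [Finset.mem_range] at hk
    rw [join_face_front x hx hi (by omega), seg_face_low x hx hi (by omega), mul_assoc]
  have e2 : ∀ r ∈ Finset.range q,
      (-1 : K) ^ (i + 1 + r) * (f (join (face x (i + 1 + r)) i q) *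
        g (seg (face x (i + 1 + r)) i (i + q))) =
      (-1 : K) ^ i * f (face (join x i q) (i + 1)) *
        ((-1 : K) ^ (r + 1) * g (face (seg x i (i + q + 1)) (r + 1))) := by
    intro r hr
    rw [Finset.mem_range] at hr
    rw [join_face_middle x hx hi (by omega) (by omega), seg_face_middle x hx hi r hr]
    ring
  have e3 : ∀ r ∈ Finset.range (p - i),
      (-1 : K) ^ (i + 1 + q + r) * (f (join (face x (i + 1 + q + r)) i q) *
        g (seg (face x (i + 1 + q + r)) i (i + q))) =
      (-1 : K) ^ (q + 1) * ((-1 : K) ^ (i + 1 + (r + 1)) *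
        f (face (join x i q) (i + 1 + (r + 1)))) * g (seg x i (i + q)) := by
    intro r hr
    rw [Finset.mem_range] at hr
    rw [show i + 1 + q + r = i + q + 1 + r by ring, join_face_back x hx hi r,
      seg_face_high x hx hi (by omega), show i + 1 + (r + 1) = i + 2 + r by ring]
    ring
  -- Expresses the faces behind the block through the front sum and the face at position `i + 1`.
  have hf' := frontSum_add_eq_zero hf x hx hi.le
  rw [show p + 1 - i = p - i + 1 by omega, Finset.sum_range_succ', add_zero] at hf'
  -- The inner faces of the segment of dimension `q + 1` are traded for its two outer faces, which
  -- are the segments of the summands `i` and `i + 1`.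
  have hg' := congrFun hg (seg x i (i + q + 1))
  rw [coboundary_of_dim_succ g _ (n := q) (by rw [seg_dim]; omega), Finset.sum_range_succ,
    Finset.sum_range_succ', face_seg_zero x hx hi, face_seg_last x hx hi, Pi.zero_apply] at hg'
  rw [show p + q + 1 = i + 1 + q + (p - i) by omega, Finset.sum_range_add, Finset.sum_range_add,
    Finset.sum_congr rfl e1, Finset.sum_congr rfl e2, Finset.sum_congr rfl e3, ← Finset.sum_mul,
    ← Finset.mul_sum, ← Finset.sum_mul, ← Finset.mul_sum, frontSum, Finset.sum_range_succ _ (i + 1),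
    face_join_succ x hx hi]
  generalize frontSum q f x i = P at *
  generalize g (seg x i (i + q)) = G at *
  generalize g (seg x (i + 1) (i + 1 + q)) = G' at *
  generalize f (face (join x i q) (i + 1)) = F at *
  rw [eq_neg_of_add_eq_zero_left hf']
  have hg'' := eq_sub_of_add_eq (eq_sub_of_add_eq hg')
  rw [hg'']
  ring

include hx in
theorem cup_eq_mul (hf' : ∀ y : Simplices S, y.1 ≠ p → f y = 0) :
    cup f g x = f (seg x 0 p) * g (seg x p x.1) := by
  refine Finset.sum_eq_single p (fun r hr hrp => ?_) (fun h => ?_)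
  · rw [hf' _ (by rw [seg_dim]; omega), zero_mul]
  · exact absurd (Finset.mem_range.2 (by omega)) h

theorem sum_telescope {ε : K} (hε : ε * ε = 1) (T : ℕ → K) (p : ℕ) :
    ∑ i ∈ Finset.range p, ε ^ i * (T (i + 1) - ε * T i) = ε * (ε ^ p * T p - T 0) := by
  induction p with
  | zero => simp
  | succ p ih =>
    rw [Finset.sum_range_succ, ih]
    linear_combination (-(ε ^ p * T (p + 1))) * hε

include hf hg hx in
-- Only the two ends of the telescoping sum survive. At `0` the joined simplex contributes the back
-- face, giving `g ∪ f`; at `p` it contributes the front face, giving `f ∪ g` up to sign.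
theorem coboundary_cupOne (hf' : ∀ y : Simplices S, y.1 ≠ p → f y = 0)
    (hg' : ∀ y : Simplices S, y.1 ≠ q → g y = 0) :
    coboundary (cupOne p q f g) x = (-1 : K) ^ (q + 1) *
      ((-1 : K) ^ (p * q) * cup f g x - cup g f x) := by
  rcases h : x.1 with _ | n
  -- On vertices both cup products are ordinary products of values in the field, so they agree.
  · obtain ⟨rfl, rfl⟩ : p = 0 ∧ q = 0 := by omega
    rw [coboundary_of_dim_zero _ x h, cup, cup, h]
    simp [mul_comm]
  · have h1 : ∀ k ∈ Finset.range (n + 2), (-1 : K) ^ k * cupOne p q f g (face x k) =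
        ∑ i ∈ Finset.range p, ((-1 : K) ^ (q + 1)) ^ i *
          ((-1 : K) ^ k * (f (join (face x k) i q) * g (seg (face x k) i (i + q)))) := by
      intro k _
      rw [cupOne, if_pos (by rw [face_dim]; omega), Finset.mul_sum]
      exact Finset.sum_congr rfl fun i _ => mul_left_comm _ _ _
    rw [coboundary_of_dim_succ _ x h, Finset.sum_congr rfl h1, Finset.sum_comm,
      show n + 2 = p + q + 1 by omega]
    have h2 : ∀ i ∈ Finset.range p, ∑ k ∈ Finset.range (p + q + 1), ((-1 : K) ^ (q + 1)) ^ i *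
          ((-1 : K) ^ k * (f (join (face x k) i q) * g (seg (face x k) i (i + q)))) =
        ((-1 : K) ^ (q + 1)) ^ i * (frontSum q f x (i + 1) * g (seg x (i + 1) (i + 1 + q)) -
          (-1 : K) ^ (q + 1) * (frontSum q f x i * g (seg x i (i + q)))) := by
      intro i hi
      rw [← Finset.mul_sum, sum_faces_cupOne hf hg x hx (Finset.mem_range.1 hi)]
    have h0 : frontSum q f x 0 = f (seg x q x.1) := by
      rw [frontSum, zero_add, Finset.sum_range_one, pow_zero, one_mul, face_join_zero x hx]
    have hp := frontSum_add_eq_zero hf x hx le_rfl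
    rw [show p + 1 - p = 1 by omega, Finset.sum_range_one, add_zero, face_join_last x hx] at hp
    rw [Finset.sum_congr rfl h2, sum_telescope (by rw [← mul_pow]; simp)
      (fun i => frontSum q f x i * g (seg x i (i + q))), h0, eq_neg_of_add_eq_zero_left hp,
      cup_eq_mul x hx hf', cup_eq_mul x (hx.trans (add_comm p q)) hg', zero_add, hx,
      show p * q = p * (q + 1) - p by rw [mul_add, mul_one, Nat.add_sub_cancel]]
    have h3 : ((-1 : K) ^ (q + 1)) ^ p = (-1 : K) ^ (p * q) * (-1 : K) ^ p := by
      rw [← pow_mul, ← pow_add]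
      congr 1
      ring
    have h4 : (-1 : K) ^ p * (-1 : K) ^ p = 1 := by rw [← mul_pow]; simp
    rw [h3, ← show p * q = p * (q + 1) - p by rw [mul_add, mul_one, Nat.add_sub_cancel]]
    rw [pow_succ _ p]
    linear_combination (-1 : K) ^ (q + 1) * (-1 : K) ^ (p * q) * f (seg x 0 p) *
      g (seg x p (p + q)) * h4

end

theorem cupOne_mem (p q : ℕ) (f g : Simplices S → K) : cupOne p q f g ∈ cochains K S :=
  ⟨p + q, fun _ hx => if_neg (by omega)⟩

/-- The graded commutator of two cocycles is a coboundary. -/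
theorem exists_coboundary_eq_commutator {n t : ℤ} {f g : cochains K S} (hf : f ∈ grading K S n)
    (hg : g ∈ grading K S t) (hdf : coboundary f.1 = 0) (hdg : coboundary g.1 = 0) :
    ∃ h : cochains K S, coboundaryLinear h = f * g - (-1 : K) ^ (n * t) • (g * f) := by
  by_cases hneg : 0 ≤ n ∧ 0 ≤ t
  · obtain ⟨⟨p, rfl⟩, q, rfl⟩ := hneg.imp Int.eq_ofNat_of_zero_le Int.eq_ofNat_of_zero_le
    -- This scalar inverts the sign in `coboundary_cupOne` and normalizes the coefficient of `f ∪ g`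
    -- to one.
    refine ⟨((-1 : K) ^ (q + 1) * (-1 : K) ^ (p * q)) •
      ⟨cupOne p q f.1 g.1, cupOne_mem _ _ _ _⟩, ?_⟩
    rw [map_smul]
    refine Subtype.ext (funext fun x => ?_)
    have hf' : ∀ y : Simplices S, y.1 ≠ p → f.1 y = 0 := fun y hy => hf y (by exact_mod_cast hy)
    have hg' : ∀ y : Simplices S, y.1 ≠ q → g.1 y = 0 := fun y hy => hg y (by exact_mod_cast hy)
    change (-1 : K) ^ (q + 1) * (-1 : K) ^ (p * q) * coboundary (cupOne p q f.1 g.1) x =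
      cup f.1 g.1 x - (-1 : K) ^ ((p : ℤ) * q) * cup g.1 f.1 x
    rw [show (-1 : K) ^ ((p : ℤ) * q) = (-1 : K) ^ (p * q) by rw [← Nat.cast_mul, zpow_natCast]]
    by_cases hx : x.1 = p + q
    · rw [coboundary_cupOne hdf hdg x hx hf' hg']
      have h1 : (-1 : K) ^ (q + 1) * (-1 : K) ^ (q + 1) = 1 := by rw [← mul_pow]; simp
      have h2 : (-1 : K) ^ (p * q) * (-1 : K) ^ (p * q) = 1 := by rw [← mul_pow]; simp
      linear_combination ((-1 : K) ^ (p * q) * (-1 : K) ^ (p * q) *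
        cup f.1 g.1 x - (-1 : K) ^ (p * q) * cup g.1 f.1 x) * h1 + cup f.1 g.1 x * h2
    · have h1 := SetLike.mul_mem_graded hf hg x (by exact_mod_cast hx)
      have h2 := SetLike.mul_mem_graded hg hf x (by rw [add_comm]; exact_mod_cast hx)
      rw [coe_mul] at h1 h2
      rw [h1, h2, mul_zero, sub_zero]
      rcases h : x.1 with _ | k
      · rw [coboundary_of_dim_zero _ x h, mul_zero]
      · rw [coboundary_of_dim_succ _ x h, Finset.sum_eq_zero, mul_zero]
        intro i _
        rw [cupOne, if_neg (by rw [face_dim]; omega), mul_zero]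
  -- There are no simplices of negative dimension, so one of the two cochains is zero.
  · refine ⟨0, ?_⟩
    have h0 : f = 0 ∨ g = 0 := by
      rw [not_and_or] at hneg
      refine hneg.imp (fun h => ?_) (fun h => ?_)
      · exact Subtype.ext (funext fun x => hf x (by omega))
      · exact Subtype.ext (funext fun x => hg x (by omega))
    rw [map_zero]
    rcases h0 with h | h <;> simp [h]

/-- The cohomology algebra of a simplicial set is graded commutative. -/
theorem grading_le_gradedCenter (t : ℤ) : (cochainDGA K S).cohomologyDGA.grading t ≤
    (cochainDGA K S).cohomologyDGA.gradedCenter t := by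
  intro z hz
  refine ⟨hz, fun n a ha => ?_⟩
  obtain ⟨g, hg, rfl⟩ := hz
  obtain ⟨f, hf, rfl⟩ := ha
  change (cochainDGA K S).cohomologyClass f * (cochainDGA K S).cohomologyClass g =
    (-1 : K) ^ (n * t) •
      ((cochainDGA K S).cohomologyClass g * (cochainDGA K S).cohomologyClass f)
  rw [← map_mul, ← map_mul, ← map_smul, ← sub_eq_zero, ← map_sub]
  exact Ideal.Quotient.eq_zero_iff_mem.2 (exists_coboundary_eq_commutator hf hg
    (congrArg Subtype.val f.2) (congrArg Subtype.val g.2))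

end SimplicialCochains

/-! ### Surjectivity of the edge homomorphism -/

namespace ColumnBicomplex

variable {K : Type u} [Field K] {D : ColumnBicomplex.{u, v} K} {E : ColumnBicomplex.{u, w} K}

theorem IsCocycle.map (F : ∀ s, D.X s →ₗ[K] E.X s)
    (hmem : ∀ s t, ∀ x ∈ D.homog s t, F s x ∈ E.homog s t)
    (hdv : ∀ s t x, F s (D.dv s t x) = E.dv s t (F s x))
    (hdh : ∀ s t x, F (s + 1) (D.dh s t x) = E.dh s t (F s x)) {n : ℤ} {x : ∀ s, D.X s}
    (hx : D.IsCocycle n x) : E.IsCocycle n fun s => F s (x s) := by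
  refine ⟨fun s => hmem _ _ _ (hx.1 s), by rw [← hdv, hx.2.1, map_zero], fun s => ?_⟩
  rw [← hdv, ← hdh, ← map_smul, ← map_add, hx.2.2, map_zero]

end ColumnBicomplex

/-! ### The cocycle of a central element and its transport along the zigzag. -/

namespace DGAlgebra

variable {K : Type u} [Field K]

namespace Rel

variable {A : DGAlgebra.{u, v} K} {B : DGAlgebra.{u, w} K}

theorem mem_hochschildCocycles_of_isCocycle {n : ℤ} {x : ∀ s, A.Multi s}
    (hx : (bicomplex (Hom.id A)).IsCocycle n x) : x ∈ A.hochschildCocycles n := by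
  refine ⟨hx.1, funext fun s => ?_⟩
  cases s with
  | zero => exact hx.2.1
  | succ s =>
    rw [totalD_succ_apply, hochschildD_id]
    exact hx.2.2 s

/-- The family with the only component `z`, in column `0`. -/
def single (A : DGAlgebra.{u, v} K) (z : B) : ∀ s, Multi A B s
  | 0 => MultilinearMap.constOfIsEmpty K _ z
  | _ + 1 => 0

/-- Column `1` is the only place with content: there the horizontal differential of `z` is its
graded commutator with `f a`, which vanishes by centrality. -/
theorem single_isCocycle (f : A.Hom B) {t : ℤ} {z : B} (hz : z ∈ B.gradedCenter t)
    (hdz : B.d z = 0) : (bicomplex f).IsCocycle t (single A z) := by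
  refine ⟨fun s => ?_, ?_, fun s => ?_⟩
  · cases s with
    | zero =>
      intro n a _
      simpa [single] using hz.1
    | succ s => exact Submodule.zero_mem _
  · refine MultilinearMap.ext fun a => ?_
    exact (internalD_apply t (single A z 0) a).trans (by simp [single, hdz]; rfl)
  · cases s with
    | succ s =>
      change (-1 : K) ^ (s + 1 + 1) • internalD _ (0 : Multi A B (s + 1 + 1)) +
        hochschildD f _ (0 : Multi A B (s + 1)) = 0
      rw [map_zero, map_zero, smul_zero, add_zero]
    | zero =>
      change (-1 : K) ^ (0 + 1) • internalD _ (0 : Multi A B (0 + 1)) +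
        hochschildD f (t - (0 : ℕ)) (single A z 0) = 0
      rw [map_zero, smul_zero, Nat.cast_zero, sub_zero]
      refine (zero_add (hochschildD f t (single A z 0))).trans ?_
      refine multi_ext fun n a ha => ?_
      rw [hochschildD_apply, B.koszul_apply t (f.map_mem _ _ (ha 0))]
      have h := hz.2 _ _ (f.map_mem _ _ (ha 0))
      simp [single, h, smul_smul, mul_comm t, neg_one_zpow_mul_self]

end Rel

/-- The edge homomorphism of a differential graded algebra `C` is surjective if there is a zigzag of
quasi-isomorphisms between `C` and a graded commutative algebra with zero differential. -/
theorem edgeHom_surjective {A : DGAlgebra.{u, v} K} {C : DGAlgebra.{u, w} K}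
    {B : DGAlgebra.{u, w'} K} {f : A.Hom C} {g : A.Hom B} (hf : f.IsQuasiIso) (hg : g.IsQuasiIso)
    (hB : ∀ b, B.d b = 0) (t : ℤ) (hcomm : B.grading t ≤ B.gradedCenter t) :
    Function.Surjective (C.edgeHom t : C.HH t → C.HGroup t) := by
  rintro ⟨c, z, hz, hzc⟩
  have hzd : C.d z = 0 := z.2
  obtain ⟨F⟩ := hf.nonempty_homotopyInverse
  obtain ⟨G⟩ := hg.nonempty_homotopyInverse
  have hamem : F.inv z ∈ A.grading t := by
    have := F.inv_mem t z hz
    rwa [add_zero] at this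
  -- The homotopy inverse of `f` moves the cocycle itself to `A`; `hright` below says that its image
  -- differs from `z` by an explicit coboundary.
  have had : A.d (F.inv z) = 0 := by rw [← F.inv_d, hzd, map_zero]
  have hright := F.right_eq z
  rw [hzd, map_zero, add_zero] at hright
  -- Lifts the central element `g (F.inv z)` to a Hochschild cocycle of `A`.
  obtain ⟨x, hx, w, -, hw⟩ := ColumnBicomplex.exists_lift (D := Rel.bicomplex (Hom.id A))
    (E := Rel.bicomplex g)
    (fun s => Rel.postcomp s g.toAlgHom.toLinearMap)
    (fun s t x => Rel.postcomp_hochschildD (Hom.id A) g g (fun _ => rfl) t x)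
    (Rel.coneAcyclic_postcomp G)
    (Rel.single_isCocycle g (hcomm (g.map_mem _ _ hamem)) (hB _))
  have hy := hx.map (E := Rel.bicomplex f) (fun s => Rel.postcomp s f.toAlgHom.toLinearMap)
    (fun s t φ hφ => by
      have := Rel.postcomp_mem f.hasDegree hφ
      rwa [add_zero] at this)
    (fun s t φ => Rel.postcomp_internalD f.map_d t φ)
    (fun s t φ => Rel.postcomp_hochschildD (Hom.id A) f f (fun _ => rfl) t φ)
  -- Extends the pushforward along `f` from arguments in `A` to arguments in `C`.
  obtain ⟨y, hy, v, -, hv⟩ := ColumnBicomplex.exists_lift (D := Rel.bicomplex (Hom.id C))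
    (E := Rel.bicomplex f)
    (fun s => Rel.precomp s f.toAlgHom.toLinearMap)
    (fun s t x => Rel.precomp_hochschildD f (Hom.id C) f (fun _ => rfl) t x)
    (Rel.coneAcyclic_precomp F) hy
  have hyc := Rel.mem_hochschildCocycles_of_isCocycle hy
  have hxc := Rel.mem_hochschildCocycles_of_isCocycle hx
  have hx0 : A.d (multiZero (x 0)) = 0 :=
    (pageCycles_two (A.hochschildCocycles_le_pageCycles 2 t hxc)).1
  -- The differential of `B` is zero, so agreement up to a coboundary is equality.
  have hw : g.toAlgHom (multiZero (x 0)) - g.toAlgHom (F.inv z) = 0 := by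
    have h1 := DFunLike.congr_fun (F := Rel.Multi A B 0) hw Fin.elim0
    have h2 := Rel.internalD_apply (t - 1) (w : Rel.Multi A B 0) Fin.elim0
    rw [hB, Fin.sum_univ_zero, smul_zero, sub_zero] at h2
    exact h1.trans h2
  -- With `b = 0` this is injectivity of `g` on cohomology: `x 0` and `F.inv z` differ by `d r`.
  obtain ⟨r, -, hr, -⟩ := hg.cone_exact (a := multiZero (x 0) - F.inv z) (b := 0)
    (by rw [map_sub, hx0, had, sub_zero]) (by rw [map_sub, hw, map_zero])
  have hv : multiZero (y 0) - f.toAlgHom (multiZero (x 0)) =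
      C.d (DFunLike.coe (F := Rel.Multi A C 0) v Fin.elim0) := by
    have h1 := DFunLike.congr_fun (F := Rel.Multi A C 0) hv Fin.elim0
    have h2 := Rel.internalD_apply (t - 1) (v : Rel.Multi A C 0) Fin.elim0
    rw [Fin.sum_univ_zero, smul_zero, sub_zero] at h2
    refine Eq.trans ?_ (h1.trans h2)
    congr 1
    exact congrArg (DFunLike.coe (F := Rel.Multi C C 0) (y 0)) (Subsingleton.elim _ _)
  refine ⟨Submodule.Quotient.mk ⟨y, hyc⟩, Subtype.ext ?_⟩
  rw [C.edgeHom_mk t ⟨y, hyc⟩]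
  refine Eq.trans ?_ hzc
  refine sub_eq_zero.1 ((map_sub C.cohomologyClass _ _).symm.trans (class_eq_zero_iff.2 ?_))
  -- With `a = F.inv z`, the summands are primitives of `y₀ - f x₀`, `f (x₀ - a)` and `f a - z`.
  refine ⟨DFunLike.coe (F := Rel.Multi A C 0) v Fin.elim0 + f.toAlgHom r + F.right z, ?_⟩
  rw [map_add, map_add, ← hv, ← f.map_d, hr, hright, map_sub]
  change _ = multiZero (y 0) - (z : C)
  abel

end DGAlgebra

/-- Formality supplies the zigzag. Graded commutativity, which holds for every space, puts all
classes in the graded center, so no class is excluded. -/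
theorem mainTheorem11 (K : Type u) [Field K] (X : Type v) [TopologicalSpace X]
    (hX : IsFormalSpace.{u, v, w} K X) (t : ℤ) :
    Function.Surjective
      ((singularCochains K X).edgeHom t :
        (singularCochains K X).HH t → (singularCochains K X).HGroup t) := by
  obtain ⟨A, f, g, hf, hg⟩ := hX
  exact DGAlgebra.edgeHom_surjective hf hg (fun _ => rfl) t
    (SimplicialCochains.grading_le_gradedCenter t)
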